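/- **Setting.** Let $c_d,c_\mu\ge 1$. A *space of homogeneous type* $(S,d,\mu)$ with constants $c_d,c_\mu$ is a set $S$ with a quasi-metric $d$ (a metric, except that the triangle inequality is replaced by $d(s,t)\le c_d\,(d(s,u)+d(u,t))$) and a measure $\mu$ on the Borel $\sigma$-algebra of $(S,d)$, such that all balls $B(s,\rho)=\{t: d(s,t)<\rho\}$, $\rho>0$, are Borel sets with $0<\mu(B(s,\rho))<\infty$ and $\mu(B(s,2\rho))\le c_\mu\,\mu(B(s,\rho))$. A *dyadic system* with parameters $c_0,C_0,\delta$ ($0<c_0\le C_0<\infty$, $0<\delta<1$) is a family $\mathscr D=\bigcup_{k\in\mathbb Z}\mathscr D_k$, where each $\mathscr D_k=\{Q^k_j\}_{j\in J_k}$ is a partition of $S$ into measurable sets with centers $z^k_j$, such that for $k\ge l$, $Q\in\mathscr D_k$, $Q'\in\mathscr D_l$ either $Q\cap Q'=\varnothing$ or $Q\subseteq Q'$, and $B(z^k_j,c_0\delta^k)\subseteq Q^k_j\subseteq B(z^k_j,C_0\delta^k)$. A cube $Q$ carries its center $z$ and generation $k$, and $\alpha Q:=B(z,\alpha C_0\delta^k)$.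 Dyadic systems $\mathscr D^1,\dots,\mathscr D^m$ with common parameters $c_0,C_0,\delta$ are *adjacent* with constant $\gamma\ge1$ if for all $s\in S$, $\rho>0$ there are $j$ and $Q\in\mathscr D^j$ with $B(s,\rho)\subseteq Q$ and $\operatorname{diam}(Q)\le\gamma\rho$. A collection $\mathcal S$ of cubes from $\mathscr D^1,\dots,\mathscr D^m$ is *$\eta$-sparse* if there are pairwise disjoint measurable sets $E_Q\subseteq Q$, $Q\in\mathcal S$, with $\mu(E_Q)\ge\eta\,\mu(Q)$. For measurable $g\ge 0$ put $\langle g\rangle_{p,Q}=\big(\frac1{\mu(Q)}\int_Q g^p\,d\mu\big)^{1/p}$. For $T$ defined on $L^{p_0}(S;X)$, with values in the (a.e. classes of) strongly measurable functions $S\to Y$, put $$\mathcal M^{\#}_{T,\alpha}f(s)=\sup_{B\ni s}\ \operatorname*{ess\,sup}_{s',s''\in B}\ \big\|T(f\mathbf 1_{S\setminus\alpha B})(s')-T(f\mathbf 1_{S\setminus\alpha B})(s'')\big\|_Y,$$ the supremum being over all balls $B=B(c,\rho)$, $c\in S$, $\rho>0$, containing $s$, with $\alpha B=B(c,\alpha\rho)$.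 The space $L^{q,\infty}$ has the quasi-norm $\sup_{t>0}t\,\mu(\|g\|>t)^{1/q}$. $T$ is *$r$-sublinear* with constant $C_r>0$ if for all $n$ and all disjointly and boundedly supported $f_1,\dots,f_n\in L^{p_0}(S;X)$ $$\Big\|T\Big(\sum_{k=1}^n f_k\Big)(s)\Big\|_Y\le C_r\Big(\sum_{k=1}^n\|Tf_k(s)\|_Y^r\Big)^{1/r}\quad\text{for a.e. }s\in S.$$ **Theorem.** Let $c_d,c_\mu\ge1$. (a) There are $0<c_0\le C_0<\infty$, $\gamma\ge1$, $0<\delta<1$ and $m\in\mathbb N$, depending only on $c_d,c_\mu$, such that every space of homogeneous type with constants $c_d,c_\mu$ has dyadic systems $\mathscr D^1,\dots,\mathscr D^m$ with parameters $c_0,C_0,\delta$ which are adjacent with constant $\gamma$. (b) Let $0<c_0\le C_0<\infty$, $\gamma\ge1$, $0<\delta<1$, $m\in\mathbb N$ be arbitrary and let $\alpha\ge 3c_d^2/\delta$. There is a constant $C>0$, depending only on $c_d,c_\mu,c_0,C_0,\gamma,\delta,m$ and $\alpha$, such that the following holds. Let $(S,d,\mu)$ be a space of homogeneous type with constants $c_d,c_\mu$,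 and let $\mathscr D^1,\dots,\mathscr D^m$ be dyadic systems on it with parameters $c_0,C_0,\delta$ which are adjacent with constant $\gamma$. Let $X,Y$ be (real or complex) Banach spaces and let $p_0,q_0,r\in[1,\infty)$. Suppose that - $T$ is a bounded linear operator from $L^{p_0}(S;X)$ to $L^{q_0,\infty}(S;Y)$; - $\mathcal M^{\#}_{T,\alpha}$ is bounded from $L^{p_0}(S;X)$ to $L^{q_0,\infty}(S)$; - $T$ is $r$-sublinear with constant $C_r$. Then there is an $\eta\in(0,1)$ such that for every boundedly supported $f\in L^{p_0}(S;X)$ there is an $\eta$-sparse collection $\mathcal S$ of cubes from $\mathscr D^1,\dots,\mathscr D^m$ with $$\|Tf(s)\|_Y\le C\,C_T\,C_r\Big(\sum_{Q\in\mathcal S}\mu(\alpha Q)^{\frac r{p_0}-\frac r{q_0}}\,\big\langle\|f\|_X\big\rangle_{p_0,Q}^r\,\mathbf 1_Q(s)\Big)^{1/r}\quad\text{for a.e. }s\in S,$$ where $C_T=\|T\|_{L^{p_0}\to L^{q_0,\infty}}+\|\mathcal M^{\#}_{T,\alpha}\|_{L^{p_0}\to L^{q_0,\infty}}$. -/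

import Mathlib

open MeasureTheory
open scoped ENNReal NNReal

universe u v w z

noncomputable section

/-- A space of homogeneous type `(S, d, μ)` with quasi-metric constant `cd` and doubling constant
`cμ`. The σ-algebra of `S` is the Borel σ-algebra of the quasi-metric topology, in which a set is
open when it contains a ball around each of its points. Balls `{t | d s t < ρ}` are assumed to be
Borel, with finite and positive measure. -/
structure HomogeneousSpace {S : Type u} [mS : MeasurableSpace S] (μ : Measure S)
    (cd cμ : ℝ) where
  d : S → S → ℝ
  d_nonneg : ∀ s t, 0 ≤ d s t
  d_eq_zero_iff : ∀ s t, d s t = 0 ↔ s = t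
  d_symm : ∀ s t, d s t = d t s
  d_triangle : ∀ s t x, d s t ≤ cd * (d s x + d x t)
  borel_eq : mS = MeasurableSpace.generateFrom
    {U : Set S | ∀ x ∈ U, ∃ ρ : ℝ, 0 < ρ ∧ {t | d x t < ρ} ⊆ U}
  measurable_ball : ∀ (s : S) (ρ : ℝ), 0 < ρ → MeasurableSet {t | d s t < ρ}
  measure_ball_pos : ∀ (s : S) (ρ : ℝ), 0 < ρ → 0 < μ {t | d s t < ρ}
  measure_ball_lt_top : ∀ (s : S) (ρ : ℝ), 0 < ρ → μ {t | d s t < ρ} < ∞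
  doubling : ∀ (s : S) (ρ : ℝ), 0 < ρ →
    μ {t | d s t < 2 * ρ} ≤ ENNReal.ofReal cμ * μ {t | d s t < ρ}

namespace HomogeneousSpace

variable {S : Type u} [MeasurableSpace S] {μ : Measure S} {cd cμ : ℝ}

/-- The ball `B(s, ρ)`. -/
def ball (H : HomogeneousSpace μ cd cμ) (s : S) (ρ : ℝ) : Set S := {t | H.d s t < ρ}

theorem measurableSet_ball (H : HomogeneousSpace μ cd cμ) (s : S) (ρ : ℝ) :
    MeasurableSet (H.ball s ρ) := by
  by_cases hρ : 0 < ρ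
  · exact H.measurable_ball s ρ hρ
  · have : H.ball s ρ = ∅ := by
      ext t
      have := H.d_nonneg s t
      simp only [ball, Set.mem_ofPred_eq, Set.mem_empty_iff_false, iff_false]
      linarith
    rw [this]
    exact MeasurableSet.empty

end HomogeneousSpace

/-- A dyadic system with parameters `c₀`, `C₀` and `δ`. A cube is encoded by its generation `k` and
its index `j : J k`, so it carries its center `center k j` and its side length `δ ^ k`. -/
structure DyadicSystem {S : Type u} [MeasurableSpace S] {μ : Measure S} {cd cμ : ℝ}
    (H : HomogeneousSpace μ cd cμ) (c₀ C₀ δ : ℝ) where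
  J : ℤ → Type u
  cube : (k : ℤ) → J k → Set S
  center : (k : ℤ) → J k → S
  measurable_cube : ∀ k j, MeasurableSet (cube k j)
  disjoint_cube : ∀ k (i j : J k), i ≠ j → Disjoint (cube k i) (cube k j)
  iUnion_cube : ∀ k, ⋃ j, cube k j = Set.univ
  nested : ∀ (k l : ℤ), l ≤ k → ∀ (i : J k) (j : J l),
    Disjoint (cube k i) (cube l j) ∨ cube k i ⊆ cube l j
  ball_subset : ∀ k j, H.ball (center k j) (c₀ * δ ^ k) ⊆ cube k j
  subset_ball : ∀ k j, cube k j ⊆ H.ball (center k j) (C₀ * δ ^ k)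

section Dyadic

variable {S : Type u} [MeasurableSpace S] {μ : Measure S} {cd cμ : ℝ}
  {H : HomogeneousSpace μ cd cμ} {c₀ C₀ δ : ℝ} {m : ℕ}

/-- Every ball is contained in a cube, of comparable diameter, of one of the dyadic systems
`D 0, …, D (m - 1)`. -/
def AdjacentSystems (D : Fin m → DyadicSystem H c₀ C₀ δ) (γ : ℝ) : Prop :=
  ∀ (s : S) (ρ : ℝ), 0 < ρ → ∃ (j : Fin m) (k : ℤ) (i : (D j).J k),
    H.ball s ρ ⊆ (D j).cube k i ∧
      ∀ x ∈ (D j).cube k i, ∀ y ∈ (D j).cube k i, H.d x y ≤ γ * ρ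

/-- A cube of one of the systems `D 0, …, D (m - 1)`, with its system, generation and index. -/
structure Cube (D : Fin m → DyadicSystem H c₀ C₀ δ) where
  sys : Fin m
  gen : ℤ
  idx : (D sys).J gen

variable {D : Fin m → DyadicSystem H c₀ C₀ δ}

/-- The set of points of a cube. -/
def Cube.carrier (Q : Cube D) : Set S := (D Q.sys).cube Q.gen Q.idx

/-- The dilation `αQ = B(z, α C₀ δ ^ k)` of a cube with center `z` and generation `k`. -/
def Cube.dilate (Q : Cube D) (α : ℝ) : Set S :=
  H.ball ((D Q.sys).center Q.gen Q.idx) (α * (C₀ * δ ^ Q.gen))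

/-- `η`-sparse collections of cubes. -/
def IsSparse (η : ℝ) (𝒮 : Set (Cube D)) : Prop :=
  ∃ E : Cube D → Set S,
    (∀ Q ∈ 𝒮, MeasurableSet (E Q) ∧ E Q ⊆ Q.carrier ∧
      ENNReal.ofReal η * μ Q.carrier ≤ μ (E Q)) ∧
    ∀ Q ∈ 𝒮, ∀ Q' ∈ 𝒮, Q ≠ Q' → Disjoint (E Q) (E Q')

end Dyadic

/-- The weak `L^q` quasi-norm `sup_{t > 0} t μ(g > t)^{1/q}` of `g ≥ 0`. -/
def weakNorm {S : Type u} [MeasurableSpace S] (μ : Measure S) (q : ℝ) (g : S → ℝ≥0∞) : ℝ≥0∞ :=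
  ⨆ t : ℝ≥0, (t : ℝ≥0∞) * μ {s | (t : ℝ≥0∞) < g s} ^ (1 / q)

/-- The operator norm from `L^p(S; X)` to weak `L^q` of an operator `A` with values in
nonnegative functions; it is `∞` if `A` is not bounded. -/
def weakOpNorm {S : Type u} [MeasurableSpace S] {μ : Measure S} {X : Type v}
    [NormedAddCommGroup X] {p : ℝ≥0∞} (q : ℝ) (A : Lp X p μ → S → ℝ≥0∞) : ℝ≥0∞ :=
  sInf {C : ℝ≥0∞ | ∀ f : Lp X p μ, weakNorm μ q (A f) ≤ C * eLpNorm f p μ}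

/-- The restriction `f 1_A`, as an element of `L^p`. -/
def indicatorLp {S : Type u} [MeasurableSpace S] {μ : Measure S} {X : Type v}
    [NormedAddCommGroup X] {p : ℝ≥0∞} {A : Set S} (hA : MeasurableSet A) (f : Lp X p μ) :
    Lp X p μ :=
  ((Lp.memLp f).indicator hA).toLp (A.indicator f)

section Operators

variable {S : Type u} [MeasurableSpace S] {μ : Measure S} {cd cμ : ℝ}
  {X : Type v} [NormedAddCommGroup X] {Y : Type w} [NormedAddCommGroup Y] {p : ℝ≥0∞}

/-- The sharp grand maximal truncation operator: at `s` it is the supremum, over the balls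
`B = B(c, ρ)` containing `s`, of the essential supremum over `(s', s'') ∈ B × B` of
`‖T(f 1_{S ∖ αB})(s') - T(f 1_{S ∖ αB})(s'')‖`, with `αB = B(c, αρ)`. -/
def sharpMaximal (H : HomogeneousSpace μ cd cμ) (α : ℝ) (T : Lp X p μ → (S →ₘ[μ] Y))
    (f : Lp X p μ) (s : S) : ℝ≥0∞ :=
  ⨆ (c : S) (ρ : ℝ) (_ : 0 < ρ) (_ : s ∈ H.ball c ρ),
    essSup (fun y : S × S =>
        ‖T (indicatorLp (H.measurableSet_ball c (α * ρ)).compl f) y.1 -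
          T (indicatorLp (H.measurableSet_ball c (α * ρ)).compl f) y.2‖ₑ)
      ((μ.restrict (H.ball c ρ)).prod (μ.restrict (H.ball c ρ)))

/-- `f` vanishes almost everywhere outside some ball. -/
def BoundedlySupported (H : HomogeneousSpace μ cd cμ) (f : Lp X p μ) : Prop :=
  ∃ (c : S) (ρ : ℝ), ∀ᵐ s ∂μ, s ∉ H.ball c ρ → f s = 0

/-- `T` is `r`-sublinear with constant `Cr`. -/
def IsSublinearWith (H : HomogeneousSpace μ cd cμ) (r Cr : ℝ)
    (T : Lp X p μ → (S →ₘ[μ] Y)) : Prop :=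
  ∀ (n : ℕ) (f : Fin n → Lp X p μ), (∀ k, BoundedlySupported H (f k)) →
    (∀ i j, i ≠ j → ∀ᵐ s ∂μ, f i s = 0 ∨ f j s = 0) →
    ∀ᵐ s ∂μ, ‖T (∑ k, f k) s‖ ≤ Cr * (∑ k, ‖T (f k) s‖ ^ r) ^ (1 / r)

/-- The fractional `ℓ^r`-sparse operator
`(∑_{Q ∈ 𝒮} μ(αQ)^{r/p₀ - r/q₀} ⟨‖f‖⟩_{p₀,Q}^r 1_Q(s))^{1/r}`, where
`⟨g⟩_{p₀,Q} = (μ(Q)⁻¹ ∫_Q g^{p₀})^{1/p₀}`. -/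
def fractionalSparse {H : HomogeneousSpace μ cd cμ} {c₀ C₀ δ : ℝ} {m : ℕ}
    {D : Fin m → DyadicSystem H c₀ C₀ δ} (𝒮 : Set (Cube D)) (α p₀ q₀ r : ℝ)
    (f : S → X) (s : S) : ℝ≥0∞ :=
  (∑' Q : 𝒮, (Q : Cube D).carrier.indicator (fun _ =>
      μ ((Q : Cube D).dilate α) ^ (r / p₀ - r / q₀) *
        ((⨍⁻ x in (Q : Cube D).carrier, ‖f x‖ₑ ^ p₀ ∂μ) ^ (1 / p₀)) ^ r) s) ^ (1 / r)

end Operators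

end

/-! Existence of adjacent systems. In each generation `k` take a maximal `δ^k`-separated net with a
measurable rounding map onto it. Rounding a point in generation `k + j` and then down one generation
at a time gives an ancestor in generation `k`; for small `δ` the errors form a geometric series, so
the ancestor stays within `2 c_d δ^k`. There is no finest generation to start from, and the
ancestors need not stabilise as `j → ∞`. Doubling, however, leaves only finitely many candidates, so
some net points recur for infinitely many `j`, and one can choose measurably a sequence of recurring
points compatible with rounding. The level sets of this choice are the cubes (`toDyadicSystem`):
they form exact, nested, measurable partitions. For adjacency, `exists_nets_dense` supplies `m` nets
per generation such that every point is very close to a point of one of them; a ball of suitable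
radius then lies in the inner ball of a cube.

Sparse domination. Fix one system. For a cube `Q` let `λ_Q` be a large multiple of `W μ(αQ)^{-1/q₀}
‖f 1_{αQ}‖_{p₀}`, with `W` the sum of the two operator norms. By the weak-type bounds, `T(f 1_{αQ})`
and its sharp maximal function are at most `λ_Q` outside a set `Ω_Q` of measure at most a small
fraction of `μ(Q)`. The children of `Q` are the maximal subcubes, at least `N` generations down, in
which `Ω_Q` has density above `θ`. Their total measure is at most `μ(Q)/2`, and by Lebesgue density
they cover almost all of `Ω_Q ∩ Q`; off them, `‖T(f 1_{αQ})‖ ≤ λ_Q`. On a child `P`, maximality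
keeps `Ω_Q ∪ Ω_P` from filling `P`, so `T(f 1_{αQ∖αP})` is at most `λ_Q + λ_P` on a set of positive
measure, and the sharp maximal function of `f 1_{αQ}` transports this to all of `P`
(`ae_enorm_increment_le`).

Almost every point lies in a finite chain of such cubes, starting from a root whose dilation
contains the support of `f`. Applying `r`-sublinearity to the telescoping sum of truncations along
the chain bounds `‖Tf‖^r` by the sum of `λ_Q^r` (`exists_chain_domination`). Finally each `Q` is
replaced by an adjacent cube `Q' ⊇ αQ` of comparable measure, which turns `λ_Q` into the fractional
average over `Q'`. The disjoint sets `Q` minus its children give sparseness and bound how many cubes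
of a chain share one `Q'`. Powers `K^{1/q₀}` and `K^{1/r}` of constants `K ≥ 1` are bounded by `K`,
so `C` does not depend on the exponents. -/

noncomputable section

/-! ### Doubling, separated sets and nets -/

namespace HomogeneousSpace

variable {S : Type u} [MeasurableSpace S] {μ : Measure S} {cd cμ : ℝ}
  (H : HomogeneousSpace μ cd cμ)

theorem mem_ball {s t : S} {ρ : ℝ} : t ∈ H.ball s ρ ↔ H.d s t < ρ := Iff.rfl

theorem d_self (s : S) : H.d s s = 0 := (H.d_eq_zero_iff s s).2 rfl

theorem mem_ball_self {s : S} {ρ : ℝ} (hρ : 0 < ρ) : s ∈ H.ball s ρ := by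
  rw [mem_ball, d_self]; exact hρ

theorem ball_subset_ball (s : S) {ρ R : ℝ} (h : ρ ≤ R) : H.ball s ρ ⊆ H.ball s R :=
  fun _ ht => lt_of_lt_of_le ht h

theorem measure_ball_two_pow_le (s : S) {ρ : ℝ} (hρ : 0 < ρ) (n : ℕ) :
    μ (H.ball s (2 ^ n * ρ)) ≤ ENNReal.ofReal cμ ^ n * μ (H.ball s ρ) := by
  induction n with
  | zero => simp
  | succ n ih =>
    have h := H.doubling s (2 ^ n * ρ) (by positivity)
    rw [← mul_assoc, ← pow_succ'] at h
    refine h.trans ?_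
    rw [pow_succ', mul_assoc]
    gcongr
    exact ih

/-- The constant with which the measures of concentric balls with radii of ratio `A` compare. -/
def _root_.doublingConst (cμ A : ℝ) : ℝ≥0∞ := ENNReal.ofReal cμ ^ ⌈A⌉₊

theorem _root_.doublingConst_ne_top (cμ A : ℝ) : doublingConst cμ A ≠ ∞ :=
  ENNReal.pow_ne_top ENNReal.ofReal_ne_top

theorem _root_.one_le_doublingConst (hcμ : 1 ≤ cμ) (A : ℝ) : 1 ≤ doublingConst cμ A :=
  one_le_pow₀ (by rwa [ENNReal.one_le_ofReal])

theorem measure_ball_le_doublingConst (s : S) {ρ R A : ℝ} (hρ : 0 < ρ) (hR : R ≤ A * ρ) :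
    μ (H.ball s R) ≤ doublingConst cμ A * μ (H.ball s ρ) := by
  refine le_trans (measure_mono (H.ball_subset_ball s ?_)) (H.measure_ball_two_pow_le s hρ ⌈A⌉₊)
  refine hR.trans (mul_le_mul_of_nonneg_right ?_ hρ.le)
  refine (Nat.le_ceil A).trans ?_
  exact_mod_cast Nat.lt_two_pow_self.le

include H in
theorem sigmaFinite : SigmaFinite μ := by
  rcases isEmpty_or_nonempty S with hS | ⟨⟨s⟩⟩
  · have : μ = 0 := Measure.eq_zero_of_isEmpty μ
    rw [this]; infer_instance
  · refine ⟨⟨⟨fun n => H.ball s (n + 1), fun _ => trivial,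
      fun n => H.measure_ball_lt_top s _ (by positivity), ?_⟩⟩⟩
    refine Set.eq_univ_of_forall fun t => Set.mem_iUnion.2 ?_
    obtain ⟨n, hn⟩ := exists_nat_gt (H.d s t)
    exact ⟨n, hn.trans (by linarith)⟩

/-- The points of `Z` are at mutual distance at least `r`. -/
def Separated (r : ℝ) (Z : Set S) : Prop := ∀ x ∈ Z, ∀ y ∈ Z, x ≠ y → r ≤ H.d x y

theorem Separated.disjoint_ball {H : HomogeneousSpace μ cd cμ} {r : ℝ} {Z : Set S}
    (hZ : H.Separated r Z) (hcd : 1 ≤ cd)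
    {x y : S} (hx : x ∈ Z) (hy : y ∈ Z) (hxy : x ≠ y) :
    Disjoint (H.ball x (r / (2 * cd))) (H.ball y (r / (2 * cd))) := by
  rw [Set.disjoint_left]
  intro t ht ht'
  rw [mem_ball] at ht ht'
  have h1 := hZ x hx y hy hxy
  have h2 := H.d_triangle x y t
  rw [H.d_symm t y] at h2
  have h3 : cd * (H.d x t + H.d y t) < cd * (r / (2 * cd) + r / (2 * cd)) :=
    mul_lt_mul_of_pos_left (by linarith) (by linarith)
  have h4 : cd * (r / (2 * cd) + r / (2 * cd)) = r := by field_simp; ring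
  linarith

theorem Separated.countable {H : HomogeneousSpace μ cd cμ} {r : ℝ} {Z : Set S}
    (hZ : H.Separated r Z) (hcd : 1 ≤ cd) (hr : 0 < r) : Z.Countable := by
  have := H.sigmaFinite
  have h := Measure.countable_meas_pos_of_disjoint_iUnion (μ := μ)
    (As := fun x : Z => H.ball (x : S) (r / (2 * cd)))
    (fun x => H.measurableSet_ball _ _)
    (fun x y hxy => hZ.disjoint_ball hcd x.2 y.2 fun h => hxy (Subtype.ext h))
  have h2 : {i : Z | 0 < μ (H.ball (i : S) (r / (2 * cd)))} = Set.univ :=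
    Set.eq_univ_of_forall fun i => H.measure_ball_pos _ _ (by positivity)
  rw [h2, Set.countable_univ_iff] at h
  exact h

/-- Packing by volume: the balls of radius `r / (2 cd)` about the points are disjoint and lie in
`B(x, 2 cd R)`, which lies in each `B(y, 4 cd² R)`. The ratio of the last radius to the first is `8
cd³ R / r`. -/
theorem Separated.card_le {H : HomogeneousSpace μ cd cμ} {r R : ℝ} {F : Finset S}
    (hF : H.Separated r (F : Set S)) (hcd : 1 ≤ cd) (hr : 0 < r) (hrR : r ≤ R) {x : S}
    (hx : ∀ y ∈ F, H.d x y < R) :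
    (F.card : ℝ≥0∞) ≤ doublingConst cμ (8 * cd ^ 3 * (R / r)) := by
  have hR : 0 < R := hr.trans_le hrR
  set B := H.ball x (2 * cd * R) with hB
  have hsub : ∀ y ∈ F, H.ball y (r / (2 * cd)) ⊆ B := by
    intro y hy t ht
    rw [mem_ball] at ht
    rw [hB, mem_ball]
    have h1 := H.d_triangle x t y
    have h2 : r / (2 * cd) ≤ R := by
      rw [div_le_iff₀ (by positivity)]; nlinarith
    have := hx y hy
    nlinarith
  have hle : ∀ y ∈ F, μ B ≤ doublingConst cμ (8 * cd ^ 3 * (R / r)) *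
      μ (H.ball y (r / (2 * cd))) := by
    intro y hy
    refine le_trans (measure_mono ?_) (H.measure_ball_le_doublingConst y (ρ := r / (2 * cd))
      (R := 4 * cd ^ 2 * R) (by positivity) (le_of_eq (by field_simp; ring)))
    intro t ht
    rw [hB, mem_ball] at ht
    rw [mem_ball]
    have h1 := H.d_triangle y t x
    rw [H.d_symm y x] at h1
    have := hx y hy
    have h5 : H.d x y + H.d x t < 4 * cd * R := by nlinarith
    calc H.d y t ≤ cd * (H.d x y + H.d x t) := h1
      _ < cd * (4 * cd * R) := mul_lt_mul_of_pos_left h5 (by linarith)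
      _ = 4 * cd ^ 2 * R := by ring
  have hsum : ∑ y ∈ F, μ (H.ball y (r / (2 * cd))) ≤ μ B := by
    rw [← measure_biUnion_finset (fun a ha b hb hab => hF.disjoint_ball hcd ha hb hab)
      (fun y _ => H.measurableSet_ball _ _)]
    exact measure_mono (Set.iUnion₂_subset hsub)
  have h0 : μ B ≠ 0 := (H.measure_ball_pos x _ (by positivity)).ne'
  have h1 : μ B ≠ ∞ := (H.measure_ball_lt_top x _ (by positivity)).ne
  have h2 : (F.card : ℝ≥0∞) * μ B ≤ doublingConst cμ (8 * cd ^ 3 * (R / r)) * μ B := by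
    calc (F.card : ℝ≥0∞) * μ B = ∑ y ∈ F, μ B := by simp
      _ ≤ ∑ y ∈ F, doublingConst cμ (8 * cd ^ 3 * (R / r)) * μ (H.ball y (r / (2 * cd))) :=
        Finset.sum_le_sum hle
      _ ≤ _ := by rw [← Finset.mul_sum]; gcongr
  exact (ENNReal.mul_le_mul_iff_left h0 h1).1 h2

theorem Separated.finite {H : HomogeneousSpace μ cd cμ} {r R : ℝ} {Z : Set S}
    (hZ : H.Separated r Z) (hcd : 1 ≤ cd) (hr : 0 < r) (x : S) :
    {y ∈ Z | H.d x y < R}.Finite := by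
  by_contra hinf
  obtain ⟨n, hn⟩ := ENNReal.exists_nat_gt
    (doublingConst_ne_top cμ (8 * cd ^ 3 * (max r R / r)))
  obtain ⟨F, hF, hcard⟩ := Set.Infinite.exists_subset_card_eq hinf n
  have := Separated.card_le (H := H) (F := F) (r := r) (R := max r R) (x := x)
    (fun a ha b hb => hZ a (hF ha).1 b (hF hb).1) hcd hr (le_max_left _ _)
    (fun y hy => (hF hy).2.trans_le (le_max_right _ _))
  rw [hcard] at this
  exact absurd this (not_le.2 hn)

theorem exists_maximal_separated (r : ℝ) {A Y : Set S} (hYA : Y ⊆ A) (hY : H.Separated r Y) :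
    ∃ Z, Y ⊆ Z ∧ Z ⊆ A ∧ H.Separated r Z ∧ ∀ a ∈ A, a ∉ Z → ∃ z ∈ Z, H.d a z < r := by
  obtain ⟨Z, hYZ, hZ⟩ := zorn_subset_nonempty {Z | Z ⊆ A ∧ H.Separated r Z} (by
    intro c hc hchain _
    refine ⟨⋃₀ c, ⟨Set.sUnion_subset fun Z hZ => (hc hZ).1, ?_⟩,
      fun Z hZ => Set.subset_sUnion_of_mem hZ⟩
    rintro x ⟨Z, hZ, hx⟩ y ⟨W, hW, hy⟩ hxy
    rcases hchain.total hZ hW with h | h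
    · exact (hc hW).2 x (h hx) y hy hxy
    · exact (hc hZ).2 x hx y (h hy) hxy) Y ⟨hYA, hY⟩
  refine ⟨Z, hYZ, hZ.prop.1, hZ.prop.2, fun a ha haZ => ?_⟩
  by_contra! hfar
  refine haZ (hZ.le_of_ge (y := insert a Z) ⟨Set.insert_subset ha hZ.prop.1, ?_⟩
    (Set.subset_insert a Z) (Set.mem_insert a Z))
  rintro x (rfl | hx) y (rfl | hy) hxy
  · exact absurd rfl hxy
  · exact hfar y hy
  · rw [H.d_symm]; exact hfar x hx
  · exact hZ.prop.2 x hx y hy hxy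

theorem exists_net (r : ℝ) (hr : 0 < r) {Y : Set S} (hY : H.Separated r Y) :
    ∃ Z, Y ⊆ Z ∧ H.Separated r Z ∧ ∀ s, ∃ z ∈ Z, H.d s z < r := by
  obtain ⟨Z, h1, -, h3, h4⟩ := H.exists_maximal_separated r (Set.subset_univ Y) hY
  refine ⟨Z, h1, h3, fun s => ?_⟩
  by_cases hs : s ∈ Z
  · exact ⟨s, hs, by rwa [d_self]⟩
  · exact h4 s trivial hs

end HomogeneousSpace

/-! ### Measurable roundings and the dyadic cubes of a system of nets -/

namespace HomogeneousSpace

open Filter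

variable {S : Type u} [MeasurableSpace S] {μ : Measure S} {cd cμ : ℝ}
  (H : HomogeneousSpace μ cd cμ)

/-- Rounding to a separated net `Z`, measurable, and equal to the nearest net point
close to the net. -/
structure IsRounding (r : ℝ) (Z : Set S) (φ : S → S) : Prop where
  mem : ∀ s, φ s ∈ Z
  dist_lt : ∀ s, H.d s (φ s) < r
  eq_of_near : ∀ s, ∀ z ∈ Z, H.d s z < r / (2 * cd) → φ s = z
  measurableSet_fiber : ∀ z ∈ Z, MeasurableSet {s | φ s = z}

theorem measurableSet_dist_lt (z : S) (r : ℝ) : MeasurableSet {s | H.d s z < r} := by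
  have h := H.measurableSet_ball z r
  have : H.ball z r = {s | H.d s z < r} := by
    ext s; rw [mem_ball, H.d_symm]; rfl
  rwa [this] at h

theorem exists_rounding (hcd : 1 ≤ cd) {r : ℝ} (hr : 0 < r) {Z : Set S}
    (hZ : H.Separated r Z) (hnet : ∀ s, ∃ z ∈ Z, H.d s z < r) :
    ∃ φ, H.IsRounding r Z φ := by
  have hcount := hZ.countable hcd hr
  obtain ⟨e, he⟩ := Set.countable_iff_exists_injOn.1 hcount
  have hr2 : r / (2 * cd) ≤ r := by rw [div_le_iff₀ (by positivity)]; nlinarith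
  have huniq : ∀ s, ∀ x ∈ Z, ∀ y ∈ Z, H.d s x < r / (2 * cd) → H.d s y < r / (2 * cd) →
      x = y := by
    intro s x hx y hy h1 h2
    by_contra hxy
    rw [H.d_symm] at h1 h2
    exact Set.disjoint_left.1 (hZ.disjoint_ball hcd hx hy hxy) h1 h2
  -- A net point within `r / (2 cd)` is unique and wins; otherwise the first net point within `r` in
  -- the enumeration `e` is taken. The fibres are thus countable Boolean combinations of balls.
  set P : S → S → Prop := fun s z => H.d s z < r ∧ (H.d s z < r / (2 * cd) ∨
    ((∀ w ∈ Z, ¬ H.d s w < r / (2 * cd)) ∧ ∀ w ∈ Z, H.d s w < r → e z ≤ e w)) with hP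
  have hex : ∀ s, ∃ z ∈ Z, P s z := by
    intro s
    by_cases h : ∃ z ∈ Z, H.d s z < r / (2 * cd)
    · obtain ⟨z, hz, hz2⟩ := h
      exact ⟨z, hz, hz2.trans_le hr2, Or.inl hz2⟩
    · push Not at h
      obtain ⟨z, ⟨hz, hzr⟩, hmin⟩ := exists_minimalFor_of_wellFoundedLT
        (fun z => z ∈ Z ∧ H.d s z < r) e (hnet s)
      refine ⟨z, hz, hzr, Or.inr ⟨fun w hw => not_lt.2 (h w hw), fun w hw hwr => ?_⟩⟩
      exact (le_total (e z) (e w)).elim id fun h => hmin ⟨hw, hwr⟩ h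
  have hPuniq : ∀ s, ∀ x ∈ Z, ∀ y ∈ Z, P s x → P s y → x = y := by
    rintro s x hx y hy ⟨hxr, hx1 | ⟨hx1, hx2⟩⟩ ⟨hyr, hy1 | ⟨hy1, hy2⟩⟩
    · exact huniq s x hx y hy hx1 hy1
    · exact absurd hx1 (hy1 x hx)
    · exact absurd hy1 (hx1 y hy)
    · exact he hx hy (le_antisymm (hx2 y hy hyr) (hy2 x hx hxr))
  choose φ hφZ hφP using hex
  refine ⟨φ, hφZ, fun s => (hφP s).1, fun s z hz hsz => ?_, fun z hz => ?_⟩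
  · exact hPuniq s _ (hφZ s) z hz (hφP s) ⟨hsz.trans_le hr2, Or.inl hsz⟩
  · have : {s | φ s = z} = {s | P s z} := by
      ext s
      exact ⟨fun h => by have := hφP s; rw [show φ s = z from h] at this; exact this,
        fun h => hPuniq s _ (hφZ s) z hz (hφP s) h⟩
    rw [this]
    refine (H.measurableSet_dist_lt z r).inter ((H.measurableSet_dist_lt z _).union ?_)
    refine MeasurableSet.inter ?_ ?_
    · have : {s | ∀ w ∈ Z, ¬ H.d s w < r / (2 * cd)} =
          ⋂ w ∈ Z, {s | H.d s w < r / (2 * cd)}ᶜ := by ext s; simp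
      change MeasurableSet {s | ∀ w ∈ Z, ¬ H.d s w < r / (2 * cd)}
      rw [this]
      exact MeasurableSet.biInter hcount fun w _ => (H.measurableSet_dist_lt w _).compl
    · have : {s | ∀ w ∈ Z, H.d s w < r → e z ≤ e w} =
          ⋂ w ∈ Z, ({s | H.d s w < r}ᶜ ∪ {_s | e z ≤ e w}) := by
        ext s
        simp only [Set.mem_iInter, Set.mem_union, Set.mem_compl_iff]
        exact forall₂_congr fun w _ => imp_iff_not_or
      change MeasurableSet {s | ∀ w ∈ Z, H.d s w < r → e z ≤ e w}
      rw [this]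
      exact MeasurableSet.biInter hcount fun w _ =>
        (H.measurableSet_dist_lt w _).compl.union (MeasurableSet.const _)

/-- Separated nets with roundings, one for each generation. -/
structure NetSystem (δ : ℝ) where
  net : ℤ → Set S
  round : ℤ → S → S
  separated : ∀ k, H.Separated (δ ^ k) (net k)
  isRounding : ∀ k, H.IsRounding (δ ^ k) (net k) (round k)

namespace NetSystem

variable {H} {δ : ℝ} (N : H.NetSystem δ)

/-- The ancestor in generation `k` of a point that is first rounded in generation `k + j`. -/
def ancestor : ℤ → ℕ → S → S
  | k, 0, s => N.round k s
  | k, j + 1, s => N.round k (ancestor (k + 1) j s)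

theorem ancestor_mem (k : ℤ) (j : ℕ) (s : S) : N.ancestor k j s ∈ N.net k := by
  cases j <;> exact (N.isRounding k).mem _

/-- The last rounding moves by less than `δ^k` and all earlier ones together by less than `2 cd
δ^(k+1) ≤ δ^k`. The quasi-triangle inequality costs one factor `cd`, so the bound reproduces itself
for every `j`. -/
theorem dist_ancestor_lt (hcd : 1 ≤ cd) (hδ : 0 < δ) (hδ' : 2 * cd * δ ≤ 1) (k : ℤ) (j : ℕ)
    (s : S) : H.d s (N.ancestor k j s) < 2 * cd * δ ^ k := by
  induction j generalizing k with
  | zero =>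
    have h1 := (N.isRounding k).dist_lt s
    have h2 : 0 < δ ^ k := zpow_pos hδ k
    change H.d s (N.round k s) < _
    nlinarith
  | succ j ih =>
    have h1 := (N.isRounding k).dist_lt (N.ancestor (k + 1) j s)
    have h2 : 0 < δ ^ k := zpow_pos hδ k
    have h3 := ih (k + 1)
    rw [zpow_add_one₀ hδ.ne'] at h3
    have h4 := H.d_triangle s (N.round k (N.ancestor (k + 1) j s)) (N.ancestor (k + 1) j s)
    change H.d s (N.round k (N.ancestor (k + 1) j s)) < _
    have h5 : 2 * cd * (δ ^ k * δ) ≤ δ ^ k := by nlinarith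
    have h6 : H.d s (N.ancestor (k + 1) j s) +
      H.d (N.ancestor (k + 1) j s) (N.round k (N.ancestor (k + 1) j s)) < 2 * δ ^ k := by linarith
    nlinarith

theorem ancestor_eq_of_near (hcd : 1 ≤ cd) (hδ : 0 < δ) (hδ' : 8 * cd ^ 3 * δ ≤ 1) {k : ℤ}
    (j : ℕ) {s z : S} (hz : z ∈ N.net k) (hs : H.d s z < 1 / (4 * cd ^ 2) * δ ^ k) :
    N.ancestor k (j + 1) s = z := by
  refine (N.isRounding k).eq_of_near _ z hz ?_
  have h0 : 0 < δ ^ k := zpow_pos hδ k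
  have hc3 : cd ≤ cd ^ 3 := by nlinarith [mul_nonneg (by linarith : 0 ≤ cd) (by nlinarith : 0 ≤ cd ^ 2 - 1)]
  have h1 := N.dist_ancestor_lt hcd hδ (by nlinarith) (k + 1) j s
  rw [zpow_add_one₀ hδ.ne', H.d_symm] at h1
  have h2 := H.d_triangle (N.ancestor (k + 1) j s) z s
  have h3 : 2 * cd * (δ ^ k * δ) ≤ 1 / (4 * cd ^ 2) * δ ^ k := by
    have : 2 * cd * δ ≤ 1 / (4 * cd ^ 2) := by
      rw [le_div_iff₀ (by positivity)]; nlinarith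
    nlinarith
  calc H.d (N.ancestor (k + 1) j s) z ≤ cd * _ := h2
    _ < cd * (1 / (4 * cd ^ 2) * δ ^ k + 1 / (4 * cd ^ 2) * δ ^ k) :=
      mul_lt_mul_of_pos_left (by linarith) (by linarith)
    _ = δ ^ k / (2 * cd) := by field_simp; ring

theorem countable_net (hcd : 1 ≤ cd) (hδ : 0 < δ) (k : ℤ) : (N.net k).Countable :=
  (N.separated k).countable hcd (zpow_pos hδ k)

theorem measurableSet_ancestor_fiber (hcd : 1 ≤ cd) (hδ : 0 < δ) (k : ℤ) (j : ℕ) {z : S}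
    (hz : z ∈ N.net k) : MeasurableSet {s | N.ancestor k j s = z} := by
  induction j generalizing k z with
  | zero => exact (N.isRounding k).measurableSet_fiber z hz
  | succ j ih =>
    have : {s | N.ancestor k (j + 1) s = z} =
        ⋃ w ∈ {w ∈ N.net (k + 1) | N.round k w = z}, {s | N.ancestor (k + 1) j s = w} := by
      ext s
      simp only [Set.mem_iUnion]
      constructor
      · intro h
        exact ⟨_, ⟨N.ancestor_mem (k + 1) j s, h⟩, rfl⟩
      · rintro ⟨w, ⟨-, hw⟩, h⟩
        change N.round k (N.ancestor (k + 1) j s) = z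
        rw [show N.ancestor (k + 1) j s = w from h, hw]
    rw [this]
    exact MeasurableSet.biUnion ((N.countable_net hcd hδ _).mono fun _ h => h.1)
      fun w hw => ih (k + 1) hw.1

/-- The net points of generation `k` that are ancestors of `s` for infinitely many starting
generations. -/
def clusterPts (k : ℤ) (s : S) : Set S := {z | ∃ᶠ j in atTop, N.ancestor k j s = z}

theorem clusterPts_subset (k : ℤ) (s : S) : N.clusterPts k s ⊆ N.net k := by
  intro z hz
  obtain ⟨j, hj⟩ := hz.exists
  exact hj ▸ N.ancestor_mem k j s

/-- Pigeonhole: all ancestors of `s` in generation `k` lie in a ball about `s`, which contains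
finitely many net points. The predicate `p` allows a given subsequence to be refined. -/
theorem exists_frequently_ancestor_eq (hcd : 1 ≤ cd) (hδ : 0 < δ) (hδ' : 2 * cd * δ ≤ 1)
    (k : ℤ) (s : S) {p : ℕ → Prop} (hp : ∃ᶠ j in atTop, p j) :
    ∃ z, ∃ᶠ j in atTop, p j ∧ N.ancestor k j s = z := by
  by_contra! h
  have hfin := (N.separated k).finite hcd (zpow_pos hδ k) s (R := 2 * cd * δ ^ k)
  have h2 := (eventually_all_finite hfin).2 fun z _ => h z
  refine hp (h2.mono fun j hj hpj => ?_)
  exact hj _ ⟨N.ancestor_mem k j s, N.dist_ancestor_lt hcd hδ hδ' k j s⟩ hpj rfl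

theorem clusterPts_nonempty (hcd : 1 ≤ cd) (hδ : 0 < δ) (hδ' : 2 * cd * δ ≤ 1) (k : ℤ) (s : S) :
    (N.clusterPts k s).Nonempty := by
  obtain ⟨z, hz⟩ := N.exists_frequently_ancestor_eq hcd hδ hδ' k s (p := fun _ => True)
    (Frequently.of_forall fun _ => trivial)
  exact ⟨z, hz.mono fun _ h => h.2⟩

theorem round_mem_clusterPts {k : ℤ} {s w : S} (hw : w ∈ N.clusterPts (k + 1) s) :
    N.round k w ∈ N.clusterPts k s := by
  refine (tendsto_add_atTop_nat 1).frequently (p := fun j => N.ancestor k j s = N.round k w)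
    (hw.mono fun j hj => ?_)
  change N.round k (N.ancestor (k + 1) j s) = _
  rw [hj]

/-- This extends a compatible sequence of recurring ancestors to the next finer generation, by
pigeonhole along the `j` whose ancestor in generation `k` is `z`. -/
theorem exists_clusterPts_round_eq (hcd : 1 ≤ cd) (hδ : 0 < δ) (hδ' : 2 * cd * δ ≤ 1) {k : ℤ}
    {s z : S} (hz : z ∈ N.clusterPts k s) : ∃ w ∈ N.clusterPts (k + 1) s, N.round k w = z := by
  have h1 : ∃ᶠ j in atTop, N.ancestor k (j + 1) s = z := by
    rw [frequently_atTop]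
    intro a
    obtain ⟨b, hb, hbz⟩ := frequently_atTop.1 hz (a + 1)
    exact ⟨b - 1, by omega, by rwa [Nat.sub_add_cancel (by omega)]⟩
  obtain ⟨w, hw⟩ := N.exists_frequently_ancestor_eq hcd hδ hδ' (k + 1) s h1
  refine ⟨w, hw.mono fun _ h => h.2, ?_⟩
  obtain ⟨j, h, h'⟩ := hw.exists
  rw [← h', ← h]; rfl

theorem measurableSet_mem_clusterPts (hcd : 1 ≤ cd) (hδ : 0 < δ) {k : ℤ} {z : S}
    (hz : z ∈ N.net k) : MeasurableSet {s | z ∈ N.clusterPts k s} := by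
  have : {s | z ∈ N.clusterPts k s} = ⋂ a : ℕ, ⋃ b : ℕ, ⋃ _ : b ≥ a,
      {s | N.ancestor k b s = z} := by
    ext s
    simp only [Set.mem_iInter, Set.mem_iUnion]
    change (∃ᶠ j in atTop, N.ancestor k j s = z) ↔ _
    rw [frequently_atTop]
    simp
  rw [this]
  exact MeasurableSet.iInter fun a => MeasurableSet.iUnion fun b => MeasurableSet.iUnion fun _ =>
    N.measurableSet_ancestor_fiber hcd hδ k b hz

/-- An element of `A` at which `e` is minimal. -/
def pick {S : Type u} (e : S → ℕ) (A : Set S) (s : S) : S :=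
  @Classical.epsilon S ⟨s⟩ fun z => z ∈ A ∧ ∀ w ∈ A, e z ≤ e w

theorem pick_spec {S : Type u} (e : S → ℕ) {A : Set S} (hA : A.Nonempty) (s : S) :
    pick e A s ∈ A ∧ ∀ w ∈ A, e (pick e A s) ≤ e w := by
  obtain ⟨z, hz, hmin⟩ := exists_minimalFor_of_wellFoundedLT (· ∈ A) e hA
  exact @Classical.epsilon_spec_aux S ⟨s⟩ (fun z => z ∈ A ∧ ∀ w ∈ A, e z ≤ e w)
    ⟨z, hz, fun w hw => (le_total (e z) (e w)).elim id fun h => hmin hw h⟩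

theorem pick_eq_iff {S : Type u} {e : S → ℕ} {A : Set S} (hA : A.Nonempty) (he : Set.InjOn e A) (s z : S) :
    pick e A s = z ↔ z ∈ A ∧ ∀ w ∈ A, e z ≤ e w := by
  have h := pick_spec e hA s
  constructor
  · rintro rfl; exact h
  · rintro ⟨h1, h2⟩
    exact he h.1 h1 (le_antisymm (h.2 z h1) (h2 _ h.1))

variable (e : ℤ → S → ℕ)

/-- The label of a point in the generations `0, 1, …`. -/
def labelNat : ℕ → S → S
  | 0, s => pick (e 0) (N.clusterPts 0 s) s
  | n + 1, s => pick (e (n + 1)) {w ∈ N.clusterPts (n + 1) s | N.round n w = labelNat n s} s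

/-- The label of a point in the generations `-1, -2, …`. -/
def labelNeg : ℕ → S → S
  | 0, s => N.round (-1) (N.labelNat e 0 s)
  | n + 1, s => N.round (Int.negSucc (n + 1)) (labelNeg n s)

/-- The center of the cube of generation `k` that contains a point. -/
def label : ℤ → S → S
  | Int.ofNat n => N.labelNat e n
  | Int.negSucc n => N.labelNeg e n

theorem labelNat_mem (hcd : 1 ≤ cd) (hδ : 0 < δ) (hδ' : 2 * cd * δ ≤ 1) (n : ℕ) (s : S) :
    N.labelNat e n s ∈ N.clusterPts n s := by
  induction n with
  | zero => exact (pick_spec _ (N.clusterPts_nonempty hcd hδ hδ' 0 s) s).1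
  | succ n ih =>
    obtain ⟨w, hw, hw'⟩ := N.exists_clusterPts_round_eq hcd hδ hδ' ih
    exact (pick_spec (e (n + 1)) (A := {w ∈ N.clusterPts (n + 1) s |
      N.round n w = N.labelNat e n s}) ⟨w, hw, hw'⟩ s).1.1

theorem labelNat_nonempty (hcd : 1 ≤ cd) (hδ : 0 < δ) (hδ' : 2 * cd * δ ≤ 1) (n : ℕ) (s : S) :
    {w ∈ N.clusterPts (n + 1) s | N.round n w = N.labelNat e n s}.Nonempty :=
  let ⟨w, hw, hw'⟩ := N.exists_clusterPts_round_eq hcd hδ hδ' (N.labelNat_mem e hcd hδ hδ' n s)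
  ⟨w, hw, hw'⟩

/-- The source of nestedness: each label is a function of the label one generation finer. -/
theorem round_label (hcd : 1 ≤ cd) (hδ : 0 < δ) (hδ' : 2 * cd * δ ≤ 1) (k : ℤ) (s : S) :
    N.round k (N.label e (k + 1) s) = N.label e k s := by
  match k with
  | Int.ofNat n =>
    exact (pick_spec (e (n + 1)) (N.labelNat_nonempty e hcd hδ hδ' n s) s).1.2
  | Int.negSucc 0 => rfl
  | Int.negSucc (n + 1) =>
    have : Int.negSucc (n + 1) + 1 = Int.negSucc n := rfl
    rw [this]; rfl

theorem label_mem (hcd : 1 ≤ cd) (hδ : 0 < δ) (hδ' : 2 * cd * δ ≤ 1) (k : ℤ) (s : S) :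
    N.label e k s ∈ N.clusterPts k s := by
  match k with
  | Int.ofNat n => exact N.labelNat_mem e hcd hδ hδ' n s
  | Int.negSucc n =>
    induction n with
    | zero => exact N.round_mem_clusterPts (k := -1) (N.labelNat_mem e hcd hδ hδ' 0 s)
    | succ n ih => exact N.round_mem_clusterPts (k := Int.negSucc (n + 1)) ih

theorem label_mem_net (hcd : 1 ≤ cd) (hδ : 0 < δ) (hδ' : 2 * cd * δ ≤ 1) (k : ℤ) (s : S) :
    N.label e k s ∈ N.net k :=
  N.clusterPts_subset k s (N.label_mem e hcd hδ hδ' k s)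

theorem measurableSet_labelNat_fiber (he : ∀ k, Set.InjOn (e k) (N.net k)) (hcd : 1 ≤ cd)
    (hδ : 0 < δ) (hδ' : 2 * cd * δ ≤ 1) (n : ℕ) {z : S} (hz : z ∈ N.net n) :
    MeasurableSet {s | N.labelNat e n s = z} := by
  induction n generalizing z with
  | zero =>
    have : {s | N.labelNat e 0 s = z} = {s | z ∈ N.clusterPts 0 s} ∩
        ⋂ w ∈ N.net 0, ({s | w ∈ N.clusterPts 0 s}ᶜ ∪ {_s | e 0 z ≤ e 0 w}) := by
      ext s
      have h := pick_eq_iff (N.clusterPts_nonempty hcd hδ hδ' 0 s)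
        ((he 0).mono (N.clusterPts_subset 0 s)) s z
      refine h.trans ?_
      simp only [Set.mem_inter_iff, Set.mem_iInter, Set.mem_union, Set.mem_compl_iff]
      refine and_congr Iff.rfl ⟨fun h w _ => imp_iff_not_or.1 (h w), fun h w hw => ?_⟩
      exact (h w (N.clusterPts_subset 0 s hw)).resolve_left fun h => h hw
    rw [this]
    exact (N.measurableSet_mem_clusterPts hcd hδ hz).inter (MeasurableSet.biInter
      (N.countable_net hcd hδ 0) fun w hw =>
        (N.measurableSet_mem_clusterPts hcd hδ hw).compl.union (MeasurableSet.const _))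
  | succ n ih =>
    -- Where the label in generation `n` equals `round n z`, the competitors of `z` are the
    -- recurring points in the rounding fibre of `z`; this fibre no longer depends on `s`.
    have : {s | N.labelNat e (n + 1) s = z} =
        ({s | N.labelNat e n s = N.round n z} ∩ {s | z ∈ N.clusterPts (n + 1) s}) ∩
        ⋂ w ∈ {w ∈ N.net (n + 1) | N.round n w = N.round n z},
          ({s | w ∈ N.clusterPts (n + 1) s}ᶜ ∪ {_s | e (n + 1) z ≤ e (n + 1) w}) := by
      ext s
      have h := pick_eq_iff (e := e (n + 1)) (N.labelNat_nonempty e hcd hδ hδ' n s)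
        ((he (n + 1)).mono fun w hw => N.clusterPts_subset (n + 1) s hw.1) s z
      refine h.trans ?_
      simp only [Set.mem_inter_iff, Set.mem_iInter, Set.mem_union, Set.mem_compl_iff]
      constructor
      · rintro ⟨⟨h1, h2⟩, h3⟩
        refine ⟨⟨h2.symm, h1⟩, fun w hw => imp_iff_not_or.1 fun hws => ?_⟩
        exact h3 w ⟨hws, hw.2.trans h2⟩
      · rintro ⟨⟨h1, h2⟩, h3⟩
        refine ⟨⟨h2, h1.symm⟩, fun w hw => ?_⟩
        exact (h3 w ⟨N.clusterPts_subset _ s hw.1, hw.2.trans h1⟩).resolve_left fun h => h hw.1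
    rw [this]
    refine ((ih ((N.isRounding n).mem z)).inter (N.measurableSet_mem_clusterPts hcd hδ hz)).inter
      (MeasurableSet.biInter ((N.countable_net hcd hδ (n + 1)).mono fun _ h => h.1) fun w hw =>
        (N.measurableSet_mem_clusterPts hcd hδ hw.1).compl.union (MeasurableSet.const _))

theorem measurableSet_round_comp_fiber (hcd : 1 ≤ cd) (hδ : 0 < δ) {k l : ℤ} {g : S → S}
    (hg : ∀ s, g s ∈ N.net l) (hm : ∀ z ∈ N.net l, MeasurableSet {s | g s = z}) (z : S) :
    MeasurableSet {s | N.round k (g s) = z} := by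
  have : {s | N.round k (g s) = z} = ⋃ w ∈ {w ∈ N.net l | N.round k w = z}, {s | g s = w} := by
    ext s
    simp only [Set.mem_iUnion]
    constructor
    · intro h
      exact ⟨_, ⟨hg s, h⟩, rfl⟩
    · rintro ⟨w, ⟨-, hw⟩, h⟩
      change N.round k (g s) = z
      rw [show g s = w from h, hw]
  rw [this]
  exact MeasurableSet.biUnion ((N.countable_net hcd hδ l).mono fun _ h => h.1)
    fun w hw => hm w hw.1

theorem measurableSet_label_fiber (he : ∀ k, Set.InjOn (e k) (N.net k)) (hcd : 1 ≤ cd)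
    (hδ : 0 < δ) (hδ' : 2 * cd * δ ≤ 1) (k : ℤ) {z : S} (hz : z ∈ N.net k) :
    MeasurableSet {s | N.label e k s = z} := by
  match k with
  | Int.ofNat n => exact N.measurableSet_labelNat_fiber e he hcd hδ hδ' n hz
  | Int.negSucc n =>
    induction n generalizing z with
    | zero =>
      exact N.measurableSet_round_comp_fiber hcd hδ (l := 0)
        (fun s => N.label_mem_net e hcd hδ hδ' 0 s)
        (fun z hz => N.measurableSet_labelNat_fiber e he hcd hδ hδ' 0 hz) z
    | succ n ih =>
      exact N.measurableSet_round_comp_fiber hcd hδ (l := Int.negSucc n)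
        (fun s => N.label_mem_net e hcd hδ hδ' (Int.negSucc n) s) (fun z hz => ih hz) z

theorem label_eq_of_le (hcd : 1 ≤ cd) (hδ : 0 < δ) (hδ' : 2 * cd * δ ≤ 1) {k l : ℤ} (hlk : l ≤ k)
    {s t : S} (h : N.label e k s = N.label e k t) : N.label e l s = N.label e l t := by
  obtain ⟨n, rfl⟩ := Int.le.dest hlk
  induction n with
  | zero => simpa using h
  | succ n ih =>
    refine ih (by omega) ?_
    rw [← N.round_label e hcd hδ hδ', ← N.round_label e hcd hδ hδ' _ t]
    have : l + ((n + 1 : ℕ) : ℤ) = l + n + 1 := by push_cast; ring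
    rw [this] at h
    rw [h]

/-- The dyadic system of a system of nets. -/
def toDyadicSystem (he : ∀ k, Set.InjOn (e k) (N.net k)) (hcd : 1 ≤ cd)
    (hδ : 0 < δ) (hδ' : 8 * cd ^ 3 * δ ≤ 1) :
    DyadicSystem H (1 / (4 * cd ^ 2)) (2 * cd) δ :=
  have hδ'' : 2 * cd * δ ≤ 1 := by
    have hc3 : cd ≤ cd ^ 3 := by
      nlinarith [mul_nonneg (by linarith : 0 ≤ cd) (by nlinarith : 0 ≤ cd ^ 2 - 1)]
    nlinarith
  { J := fun k => N.net k
    cube := fun k j => {s | N.label e k s = j}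
    center := fun _ j => j
    measurable_cube := fun k j => N.measurableSet_label_fiber e he hcd hδ hδ'' k j.2
    disjoint_cube := fun k i j hij => by
      rw [Set.disjoint_left]
      intro s hs hs'
      exact hij (Subtype.ext ((show N.label e k s = i from hs).symm.trans hs'))
    iUnion_cube := fun k => Set.eq_univ_of_forall fun s => Set.mem_iUnion.2
      ⟨⟨_, N.label_mem_net e hcd hδ hδ'' k s⟩, rfl⟩
    nested := fun k l hlk i j => by
      rw [or_iff_not_imp_left, Set.not_disjoint_iff]
      rintro ⟨s, hs, hs'⟩ t ht
      have h1 : N.label e k t = N.label e k s :=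
        (show N.label e k t = i from ht).trans (show N.label e k s = i from hs).symm
      exact (N.label_eq_of_le e hcd hδ hδ'' hlk h1).trans hs'
    ball_subset := fun k j s hs => by
      have h1 : H.d s j < 1 / (4 * cd ^ 2) * δ ^ k := by rw [H.d_symm]; exact hs
      have h2 := N.label_mem e hcd hδ hδ'' k s
      -- The label recurs, hence is an ancestor of index at least `1`; near `j` all such ancestors
      -- equal `j`.
      obtain ⟨i, hi, h3⟩ := frequently_atTop.1 h2 1
      obtain ⟨i, rfl⟩ : ∃ i', i = i' + 1 := ⟨i - 1, by omega⟩
      rw [N.ancestor_eq_of_near hcd hδ hδ' i j.2 h1] at h3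
      exact h3.symm
    subset_ball := fun k j s hs => by
      obtain ⟨i, hi⟩ := (N.label_mem e hcd hδ hδ'' k s).exists
      have h := N.dist_ancestor_lt hcd hδ hδ'' k i s
      rw [hi, show N.label e k s = j from hs] at h
      rw [mem_ball, H.d_symm]; exact h }

end NetSystem

/-! ### Finitely many nets per generation and adjacency -/

/-- For some `m` that depends on the ratio `r / ε` only, `m` separated nets can be chosen in such
a way that every point is close to one of them. -/
theorem exists_nets_dense (hcd : 1 ≤ cd) {r ε : ℝ} (hε : 0 < ε) (hεr : ε ≤ r) (m : ℕ)
    (hm : doublingConst cμ (8 * cd ^ 3 * (r / ε)) < m) :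
    ∃ Z : Fin m → Set S, (∀ t, H.Separated r (Z t)) ∧ (∀ t s, ∃ z ∈ Z t, H.d s z < r) ∧
      ∀ s, ∃ t, ∃ z ∈ Z t, H.d s z < ε := by
  have hr : 0 < r := hε.trans_le hεr
  obtain ⟨A, -, hA, hAnet⟩ := H.exists_net ε hε (Y := ∅) (fun x hx => hx.elim)
  -- Greedy layers: remove from the fine net `A` a maximal `r`-separated subset, `n` times. A point
  -- never removed has a neighbour within `r` in every layer.
  have key : ∀ n : ℕ, ∃ Y : Fin n → Set S, (∀ t, H.Separated r (Y t)) ∧ (∀ t, Y t ⊆ A) ∧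
      Pairwise (fun t t' => Disjoint (Y t) (Y t')) ∧
      ∀ a ∈ A, (∀ t, a ∉ Y t) → ∀ t, ∃ z ∈ Y t, H.d a z < r := by
    intro n
    induction n with
    | zero => exact ⟨fun _ => ∅, fun t => t.elim0, fun t => t.elim0, fun t => t.elim0,
        fun _ _ _ t => t.elim0⟩
    | succ n ih =>
      obtain ⟨Y, h1, h2, h3, h4⟩ := ih
      obtain ⟨W, -, hW1, hW2, hW3⟩ := H.exists_maximal_separated r
        (A := {a ∈ A | ∀ t, a ∉ Y t}) (Set.empty_subset _) (fun x hx => hx.elim)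
      have hdisj : ∀ t, Disjoint (Y t) W := fun t =>
        Set.disjoint_left.2 fun a ha haW => (hW1 haW).2 t ha
      refine ⟨Fin.snoc (α := fun _ => Set S) Y W, ?_, ?_, ?_, ?_⟩
      · intro t
        refine Fin.lastCases ?_ (fun t => ?_) t
        · rw [Fin.snoc_last]; exact hW2
        · rw [Fin.snoc_castSucc]; exact h1 t
      · intro t
        refine Fin.lastCases ?_ (fun t => ?_) t
        · rw [Fin.snoc_last]; exact fun a ha => (hW1 ha).1
        · rw [Fin.snoc_castSucc]; exact h2 t
      · intro t t'
        refine Fin.lastCases ?_ (fun t => ?_) t <;> refine Fin.lastCases ?_ (fun t' => ?_) t'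
        · intro h; exact absurd rfl h
        · intro _; rw [Fin.snoc_last, Fin.snoc_castSucc]; exact (hdisj t').symm
        · intro _; rw [Fin.snoc_last, Fin.snoc_castSucc]; exact hdisj t
        · intro h; rw [Fin.snoc_castSucc, Fin.snoc_castSucc]
          exact h3 fun h' => h (by rw [h'])
      · intro a ha haY
        have ha1 : ∀ t, a ∉ Y t := fun t => by
          have := haY t.castSucc; rwa [Fin.snoc_castSucc] at this
        have ha2 : a ∉ W := by have := haY (Fin.last n); rwa [Fin.snoc_last] at this
        intro t
        refine Fin.lastCases ?_ (fun t => ?_) t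
        · rw [Fin.snoc_last]; exact hW3 a ⟨ha, ha1⟩ ha2
        · rw [Fin.snoc_castSucc]; exact h4 a ha ha1 t
  obtain ⟨Y, h1, h2, h3, h4⟩ := key m
  have hcover : ∀ a ∈ A, ∃ t, a ∈ Y t := by
    intro a ha
    -- A point surviving `m` rounds would have `m` distinct, mutually `ε`-separated neighbours
    -- within `r`, more than packing allows.
    by_contra! hcon
    choose y hy hay using h4 a ha hcon
    have hinj : Function.Injective y := by
      intro t t' htt
      by_contra hne
      exact Set.disjoint_left.1 (h3 hne) (hy t) (htt ▸ hy t')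
    classical
    have := Separated.card_le (H := H) (F := Finset.univ.image y) (r := ε) (R := r) (x := a)
      (fun b hb c hc hbc => by
        have hb' : b ∈ Finset.univ.image y := hb
        have hc' : c ∈ Finset.univ.image y := hc
        rw [Finset.mem_image] at hb' hc'
        obtain ⟨t, -, rfl⟩ := hb'
        obtain ⟨t', -, rfl⟩ := hc'
        exact hA _ (h2 t (hy t)) _ (h2 t' (hy t')) hbc) hcd hε hεr
      (fun b hb => by
        rw [Finset.mem_image] at hb
        obtain ⟨t, -, rfl⟩ := hb
        exact hay t)
    rw [Finset.card_image_of_injective _ hinj, Finset.card_univ, Fintype.card_fin] at this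
    exact absurd this (not_le.2 hm)
  choose Z hYZ hZ1 hZ2 using fun t => H.exists_net r hr (h1 t)
  refine ⟨Z, hZ1, hZ2, fun s => ?_⟩
  obtain ⟨a, ha, hsa⟩ := hAnet s
  obtain ⟨t, ht⟩ := hcover a ha
  exact ⟨t, a, hYZ t ht, hsa⟩

end HomogeneousSpace

theorem exists_adjacentSystems (cd cμ : ℝ) (hcd : 1 ≤ cd) :
    ∃ (c₀ C₀ γ δ : ℝ) (m : ℕ), 0 < c₀ ∧ c₀ ≤ C₀ ∧ 1 ≤ γ ∧ 0 < δ ∧ δ < 1 ∧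
      ∀ (S : Type u) [MeasurableSpace S] (μ : Measure S) (H : HomogeneousSpace μ cd cμ),
        ∃ D : Fin m → DyadicSystem H c₀ C₀ δ, AdjacentSystems D γ := by
  have hcd3 : 1 ≤ cd ^ 3 := one_le_pow₀ hcd
  have hcd2 : 1 ≤ cd ^ 2 := one_le_pow₀ hcd
  set c₀ : ℝ := 1 / (4 * cd ^ 2) with hc₀
  set δ : ℝ := 1 / (8 * cd ^ 3) with hδ
  have hδ0 : 0 < δ := by positivity
  have hδ1 : δ < 1 := by rw [hδ, div_lt_one (by positivity)]; linarith
  have hδ8 : 8 * cd ^ 3 * δ ≤ 1 := le_of_eq (by rw [hδ]; field_simp)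
  have hc₀0 : 0 < c₀ := by positivity
  have hc₀1 : c₀ ≤ 1 := by rw [hc₀, div_le_one (by positivity)]; linarith
  -- Chosen so that a ball of radius at most `θ δ^k` whose centre is within `θ δ^k` of `z` lies in
  -- `B(z, c₀ δ^k)`.
  set θ : ℝ := c₀ / (2 * cd) with hθ
  have hθ0 : 0 < θ := by positivity
  have hθ1 : θ ≤ 1 := by rw [hθ, div_le_one (by positivity)]; linarith
  obtain ⟨m, hm⟩ := ENNReal.exists_nat_gt (doublingConst_ne_top cμ (8 * cd ^ 3 * (1 / θ)))
  refine ⟨c₀, 2 * cd, 4 * cd ^ 2 / (θ * δ), δ, m, hc₀0, by linarith, ?_, hδ0, hδ1, ?_⟩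
  · rw [le_div_iff₀ (by positivity)]
    nlinarith [mul_le_one₀ hθ1 hδ0.le hδ1.le]
  intro S _ μ H
  have hpow : ∀ k : ℤ, 0 < δ ^ k := fun k => zpow_pos hδ0 k
  have hnets := fun k : ℤ => H.exists_nets_dense hcd (r := δ ^ k) (ε := θ * δ ^ k)
    (mul_pos hθ0 (hpow k)) (by nlinarith [hpow k]) m
    (by rwa [show δ ^ k / (θ * δ ^ k) = 1 / θ by field_simp [(hpow k).ne']])
  choose Z hsep hnet hdense using hnets
  choose φ hφ using fun (k : ℤ) (t : Fin m) =>
    H.exists_rounding hcd (hpow k) (hsep k t) (hnet k t)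
  let N : Fin m → H.NetSystem δ := fun t =>
    ⟨fun k => Z k t, fun k => φ k t, fun k => hsep k t, fun k => hφ k t⟩
  choose e he using fun (k : ℤ) (t : Fin m) =>
    Set.countable_iff_exists_injOn.1 ((hsep k t).countable hcd (hpow k))
  refine ⟨fun t => (N t).toDyadicSystem (fun k => e k t) (fun k => he k t) hcd hδ0 hδ8, ?_⟩
  intro s ρ hρ
  -- This selects the generation `k` with `θ δ^(k+1) < ρ ≤ θ δ^k`; the lower bound on `ρ` controls
  -- the diameter of the cube.
  obtain ⟨n, hn1, hn2⟩ := exists_mem_Ioc_zpow (x := ρ / θ) (y := δ⁻¹) (by positivity)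
    ((one_lt_inv₀ hδ0).2 hδ1)
  obtain ⟨k, rfl⟩ : ∃ k : ℤ, n = -k - 1 := ⟨-n - 1, by ring⟩
  rw [inv_zpow', show -(-k - 1) = k + 1 by ring, zpow_add_one₀ hδ0.ne', lt_div_iff₀ hθ0] at hn1
  rw [inv_zpow', show -(-k - 1 + 1) = k by ring, div_le_iff₀ hθ0] at hn2
  obtain ⟨t, z, hz, hsz⟩ := hdense k s
  have hsub : H.ball s ρ ⊆ H.ball z (c₀ * δ ^ k) := by
    intro x hx
    rw [HomogeneousSpace.mem_ball] at hx ⊢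
    have h := H.d_triangle z x s
    rw [H.d_symm z s] at h
    calc H.d z x ≤ cd * (H.d s z + H.d s x) := h
      _ < cd * (θ * δ ^ k + δ ^ k * θ) := mul_lt_mul_of_pos_left (by linarith) (by linarith)
      _ = c₀ * δ ^ k := by rw [hθ]; field_simp; ring
  set 𝒟 := (N t).toDyadicSystem (fun k => e k t) (fun k => he k t) hcd hδ0 hδ8
  refine ⟨t, k, ⟨z, hz⟩, hsub.trans (𝒟.ball_subset k ⟨z, hz⟩), fun x hx y hy => ?_⟩
  have hx' := 𝒟.subset_ball k _ hx
  have hy' := 𝒟.subset_ball k _ hy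
  rw [HomogeneousSpace.mem_ball] at hx' hy'
  have h := H.d_triangle x y (𝒟.center k ⟨z, hz⟩)
  rw [H.d_symm x (𝒟.center k ⟨z, hz⟩)] at h
  have hk := hpow k
  calc H.d x y ≤ cd * (H.d (𝒟.center k ⟨z, hz⟩) x + H.d (𝒟.center k ⟨z, hz⟩) y) := h
    _ ≤ cd * (2 * cd * δ ^ k + 2 * cd * δ ^ k) :=
      mul_le_mul_of_nonneg_left (by linarith) (by linarith)
    _ = 4 * cd ^ 2 / (θ * δ) * (δ ^ k * δ * θ) := by field_simp; ring
    _ ≤ 4 * cd ^ 2 / (θ * δ) * ρ := mul_le_mul_of_nonneg_left hn1.le (by positivity)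

/-! ### Geometry of the cubes of one dyadic system -/

namespace DyadicSystem

open Filter Topology

variable {S : Type u} [mS : MeasurableSpace S] {μ : Measure S} {cd cμ : ℝ}
  {H : HomogeneousSpace μ cd cμ} {c₀ C₀ δ : ℝ} (𝒟 : DyadicSystem H c₀ C₀ δ)

/-- The cubes of a dyadic system, with their generation and index. -/
def Idx : Type u := Σ k, 𝒟.J k

/-- The generation of a cube. -/
def gen (Q : 𝒟.Idx) : ℤ := Q.1

/-- The set of points of a cube. -/
def carrier (Q : 𝒟.Idx) : Set S := 𝒟.cube Q.1 Q.2

/-- The center of a cube. -/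
def mid (Q : 𝒟.Idx) : S := 𝒟.center Q.1 Q.2

/-- The ball `αQ`. -/
def dilation (α : ℝ) (Q : 𝒟.Idx) : Set S := H.ball (𝒟.mid Q) (α * (C₀ * δ ^ 𝒟.gen Q))

theorem exists_mem_cube (k : ℤ) (s : S) : ∃ j, s ∈ 𝒟.cube k j := by
  have : s ∈ ⋃ j, 𝒟.cube k j := by rw [𝒟.iUnion_cube]; trivial
  exact Set.mem_iUnion.1 this

/-- The index of the cube of generation `k` that contains a point. -/
def index (k : ℤ) (s : S) : 𝒟.J k := (𝒟.exists_mem_cube k s).choose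

/-- The cube of generation `k` that contains a point. -/
def cubeAt (k : ℤ) (s : S) : 𝒟.Idx := ⟨k, 𝒟.index k s⟩

theorem mem_cube_index (k : ℤ) (s : S) : s ∈ 𝒟.cube k (𝒟.index k s) :=
  (𝒟.exists_mem_cube k s).choose_spec

theorem mem_cubeAt (k : ℤ) (s : S) : s ∈ 𝒟.carrier (𝒟.cubeAt k s) := 𝒟.mem_cube_index k s

theorem index_eq {k : ℤ} {s : S} {j : 𝒟.J k} (h : s ∈ 𝒟.cube k j) : 𝒟.index k s = j := by
  by_contra hne
  exact Set.disjoint_left.1 (𝒟.disjoint_cube k _ _ hne) (𝒟.mem_cube_index k s) h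

theorem mem_cube_iff {k : ℤ} {s : S} {j : 𝒟.J k} : s ∈ 𝒟.cube k j ↔ 𝒟.index k s = j :=
  ⟨𝒟.index_eq, fun h => h ▸ 𝒟.mem_cube_index k s⟩

theorem cubeAt_eq {Q : 𝒟.Idx} {s : S} (h : s ∈ 𝒟.carrier Q) : 𝒟.cubeAt (𝒟.gen Q) s = Q := by
  obtain ⟨k, j⟩ := Q
  exact congrArg (Sigma.mk k) (𝒟.index_eq h)

theorem carrier_subset_of_le {P Q : 𝒟.Idx} (h : 𝒟.gen Q ≤ 𝒟.gen P) {s : S}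
    (hP : s ∈ 𝒟.carrier P) (hQ : s ∈ 𝒟.carrier Q) : 𝒟.carrier P ⊆ 𝒟.carrier Q :=
  (𝒟.nested _ _ h P.2 Q.2).resolve_left fun hd => Set.disjoint_left.1 hd hP hQ

theorem eq_of_gen_eq {P Q : 𝒟.Idx} (h : 𝒟.gen P = 𝒟.gen Q) {s : S}
    (hP : s ∈ 𝒟.carrier P) (hQ : s ∈ 𝒟.carrier Q) : P = Q := by
  rw [← 𝒟.cubeAt_eq hP, ← 𝒟.cubeAt_eq hQ, h]

theorem index_eq_of_le {k l : ℤ} (h : l ≤ k) {s t : S} (hst : 𝒟.index k s = 𝒟.index k t) :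
    𝒟.index l s = 𝒟.index l t := by
  have h1 := 𝒟.carrier_subset_of_le (P := 𝒟.cubeAt k t) (Q := 𝒟.cubeAt l t) h (𝒟.mem_cubeAt k t)
    (𝒟.mem_cubeAt l t)
  exact 𝒟.index_eq (h1 (𝒟.mem_cube_iff.2 hst))

theorem measurableSet_carrier (Q : 𝒟.Idx) : MeasurableSet (𝒟.carrier Q) := 𝒟.measurable_cube _ _

theorem carrier_subset_ball (Q : 𝒟.Idx) : 𝒟.carrier Q ⊆ H.ball (𝒟.mid Q) (C₀ * δ ^ 𝒟.gen Q) :=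
  𝒟.subset_ball _ _

theorem ball_subset_carrier (Q : 𝒟.Idx) : H.ball (𝒟.mid Q) (c₀ * δ ^ 𝒟.gen Q) ⊆ 𝒟.carrier Q :=
  𝒟.ball_subset _ _

theorem measurableSet_dilation (α : ℝ) (Q : 𝒟.Idx) : MeasurableSet (𝒟.dilation α Q) :=
  H.measurableSet_ball _ _

theorem mid_mem (hc : 0 < c₀) (hδ : 0 < δ) (Q : 𝒟.Idx) : 𝒟.mid Q ∈ 𝒟.carrier Q :=
  𝒟.ball_subset_carrier Q (H.mem_ball_self (mul_pos hc (zpow_pos hδ _)))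

theorem measure_carrier_pos (hc : 0 < c₀) (hδ : 0 < δ) (Q : 𝒟.Idx) : 0 < μ (𝒟.carrier Q) :=
  (H.measure_ball_pos _ _ (mul_pos hc (zpow_pos hδ _))).trans_le
    (measure_mono (𝒟.ball_subset_carrier Q))

theorem measure_carrier_lt_top (hC : 0 < C₀) (hδ : 0 < δ) (Q : 𝒟.Idx) : μ (𝒟.carrier Q) < ∞ :=
  (measure_mono (𝒟.carrier_subset_ball Q)).trans_lt
    (H.measure_ball_lt_top _ _ (mul_pos hC (zpow_pos hδ _)))

theorem countable_J (hc : 0 < c₀) (hδ : 0 < δ) (k : ℤ) : Countable (𝒟.J k) := by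
  have := H.sigmaFinite
  have h := Measure.countable_meas_pos_of_disjoint_iUnion (μ := μ) (As := 𝒟.cube k)
    (fun j => 𝒟.measurable_cube k j) (fun i j hij => 𝒟.disjoint_cube k i j hij)
  have h2 : {j | 0 < μ (𝒟.cube k j)} = Set.univ :=
    Set.eq_univ_of_forall fun j => 𝒟.measure_carrier_pos hc hδ ⟨k, j⟩
  rwa [h2, Set.countable_univ_iff] at h

theorem countable_Idx (hc : 0 < c₀) (hδ : 0 < δ) : Countable 𝒟.Idx := by
  have := 𝒟.countable_J hc hδ
  unfold Idx
  infer_instance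

theorem carrier_subset_dilation (hC : 0 < C₀) (hδ : 0 < δ) {α : ℝ} (hα : 1 ≤ α) (Q : 𝒟.Idx) :
    𝒟.carrier Q ⊆ 𝒟.dilation α Q := by
  refine (𝒟.carrier_subset_ball Q).trans (H.ball_subset_ball _ ?_)
  have : 0 < C₀ * δ ^ 𝒟.gen Q := mul_pos hC (zpow_pos hδ _)
  nlinarith

theorem measure_dilation_le (hc : 0 < c₀) (hδ : 0 < δ) (α : ℝ) (Q : 𝒟.Idx) :
    μ (𝒟.dilation α Q) ≤ doublingConst cμ (α * C₀ / c₀) * μ (𝒟.carrier Q) := by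
  refine (H.measure_ball_le_doublingConst (𝒟.mid Q) (ρ := c₀ * δ ^ 𝒟.gen Q)
    (A := α * C₀ / c₀) (mul_pos hc (zpow_pos hδ _)) (le_of_eq (by field_simp))).trans ?_
  gcongr
  exact 𝒟.ball_subset_carrier Q

theorem measure_dilation_pos (hC : 0 < C₀) (hδ : 0 < δ) {α : ℝ} (hα : 0 < α) (Q : 𝒟.Idx) :
    0 < μ (𝒟.dilation α Q) :=
  H.measure_ball_pos _ _ (mul_pos hα (mul_pos hC (zpow_pos hδ _)))

theorem measure_dilation_lt_top (hC : 0 < C₀) (hδ : 0 < δ) {α : ℝ} (hα : 0 < α) (Q : 𝒟.Idx) :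
    μ (𝒟.dilation α Q) < ∞ :=
  H.measure_ball_lt_top _ _ (mul_pos hα (mul_pos hC (zpow_pos hδ _)))

theorem measure_carrier_le_of_subset (hcd : 1 ≤ cd) (hc : 0 < c₀) (hC : 0 < C₀) (hδ : 0 < δ)
    (hδ1 : δ < 1) {N : ℕ} {P Q : 𝒟.Idx} (hPQ : 𝒟.carrier P ⊆ 𝒟.carrier Q)
    (hgen : 𝒟.gen P ≤ 𝒟.gen Q + N) :
    μ (𝒟.carrier Q) ≤ doublingConst cμ (2 * cd * C₀ / (c₀ * δ ^ N)) * μ (𝒟.carrier P) := by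
  have hzP := 𝒟.carrier_subset_ball Q (hPQ (𝒟.mid_mem hc hδ P))
  have hpow : 0 < δ ^ 𝒟.gen Q := zpow_pos hδ _
  have hsub : 𝒟.carrier Q ⊆ H.ball (𝒟.mid P) (2 * cd * C₀ * δ ^ 𝒟.gen Q) := by
    intro x hx
    have hx := 𝒟.carrier_subset_ball Q hx
    rw [HomogeneousSpace.mem_ball] at hzP hx ⊢
    have h := H.d_triangle (𝒟.mid P) x (𝒟.mid Q)
    rw [H.d_symm (𝒟.mid P) (𝒟.mid Q)] at h
    calc H.d (𝒟.mid P) x ≤ cd * (H.d (𝒟.mid Q) (𝒟.mid P) + H.d (𝒟.mid Q) x) := h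
      _ < cd * (C₀ * δ ^ 𝒟.gen Q + C₀ * δ ^ 𝒟.gen Q) :=
        mul_lt_mul_of_pos_left (by linarith) (by linarith)
      _ = _ := by ring
  refine (measure_mono hsub).trans ((H.measure_ball_le_doublingConst (𝒟.mid P)
    (ρ := c₀ * δ ^ 𝒟.gen P) (A := 2 * cd * C₀ / (c₀ * δ ^ N))
    (mul_pos hc (zpow_pos hδ _)) ?_).trans ?_)
  · have h1 : δ ^ 𝒟.gen Q * δ ^ N ≤ δ ^ 𝒟.gen P := by
      rw [← zpow_natCast, ← zpow_add₀ hδ.ne']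
      exact zpow_le_zpow_right_of_le_one₀ hδ hδ1.le hgen
    rw [div_mul_eq_mul_div, le_div_iff₀ (by positivity)]
    calc 2 * cd * C₀ * δ ^ 𝒟.gen Q * (c₀ * δ ^ N)
        = 2 * cd * C₀ * c₀ * (δ ^ 𝒟.gen Q * δ ^ N) := by ring
      _ ≤ 2 * cd * C₀ * c₀ * δ ^ 𝒟.gen P := by gcongr
      _ = _ := by ring
  · gcongr
    exact 𝒟.ball_subset_carrier P

/-- With a quasi-metric, nested cubes need not have nested dilations. A gap of `N` generations
absorbs the factor `cd`: the two contributions are at most `α / 3` and `2 α / 3`. This is why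
stopping children start `N` generations down. -/
theorem dilation_subset_dilation (hcd : 1 ≤ cd) (hc : 0 < c₀) (hC : 0 < C₀) (hδ : 0 < δ)
    (hδ1 : δ < 1) {α : ℝ} (hα : 3 * cd ≤ α) {N : ℕ} (hN : cd * δ ^ N ≤ 2 / 3) {P Q : 𝒟.Idx}
    (hPQ : 𝒟.carrier P ⊆ 𝒟.carrier Q) (hgen : 𝒟.gen Q + N ≤ 𝒟.gen P) :
    𝒟.dilation α P ⊆ 𝒟.dilation α Q := by
  have hzP := 𝒟.carrier_subset_ball Q (hPQ (𝒟.mid_mem hc hδ P))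
  have hpow : 0 < δ ^ 𝒟.gen Q := zpow_pos hδ _
  have h1 : δ ^ 𝒟.gen P ≤ δ ^ 𝒟.gen Q * δ ^ N := by
    rw [← zpow_natCast, ← zpow_add₀ hδ.ne']
    exact zpow_le_zpow_right_of_le_one₀ hδ hδ1.le hgen
  intro x hx
  rw [dilation, HomogeneousSpace.mem_ball] at hx ⊢
  rw [HomogeneousSpace.mem_ball] at hzP
  have h := H.d_triangle (𝒟.mid Q) x (𝒟.mid P)
  have hα0 : 0 < α := by linarith
  calc H.d (𝒟.mid Q) x ≤ cd * (H.d (𝒟.mid Q) (𝒟.mid P) + H.d (𝒟.mid P) x) := h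
    _ < cd * (C₀ * δ ^ 𝒟.gen Q + α * (C₀ * δ ^ 𝒟.gen P)) :=
        mul_lt_mul_of_pos_left (by linarith) (by linarith)
    _ ≤ cd * (C₀ * δ ^ 𝒟.gen Q + α * (C₀ * (δ ^ 𝒟.gen Q * δ ^ N))) := by gcongr
    _ = C₀ * δ ^ 𝒟.gen Q * (cd + α * (cd * δ ^ N)) := by ring
    _ ≤ C₀ * δ ^ 𝒟.gen Q * (α / 3 + α * (2 / 3)) := by gcongr; linarith
    _ = α * (C₀ * δ ^ 𝒟.gen Q) := by ring

/-- The points of `S` can be partitioned into cubes whose dilations contain a given ball. -/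
theorem exists_roots (hcd : 1 ≤ cd) (hc : 0 < c₀) (hC : 0 < C₀) (hδ : 0 < δ)
    (hδ1 : δ < 1) {α : ℝ} (hα : 3 * cd ^ 2 / δ ≤ α) (c : S) (ρ : ℝ) :
    ∃ roots : Set 𝒟.Idx, (∀ P ∈ roots, ∀ Q ∈ roots, ∀ s ∈ 𝒟.carrier P, s ∈ 𝒟.carrier Q → P = Q) ∧
      (∀ s, ∃ Q ∈ roots, s ∈ 𝒟.carrier Q) ∧ ∀ Q ∈ roots, H.ball c ρ ⊆ 𝒟.dilation α Q := by
  have hpow : ∀ k : ℤ, 0 < C₀ * δ ^ k := fun k => mul_pos hC (zpow_pos hδ _)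
  have hα' : 3 * cd ^ 2 ≤ α * δ := (div_le_iff₀ hδ).1 hα
  have hα0 : 0 < α := pos_of_mul_pos_left (lt_of_lt_of_le (by positivity) hα') hδ.le
  -- In a one-point space every cube would be good below, and no coarsest bad cube would exist.
  by_cases hsub : ∀ x, x = c
  · refine ⟨{𝒟.cubeAt 0 c}, ?_, fun s => ⟨_, rfl, ?_⟩, ?_⟩
    · rintro P rfl Q rfl _ _ _; rfl
    · rw [hsub s]; exact 𝒟.mem_cubeAt 0 c
    · rintro Q - x -
      rw [hsub x, ← hsub (𝒟.mid Q)]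
      exact H.mem_ball_self (mul_pos hα0 (hpow _))
  push Not at hsub
  obtain ⟨y, hy⟩ := hsub
  -- The ball is enlarged to contain two distinct points, so that sufficiently small cubes are bad.
  obtain ⟨R, hRρ, hRy, hR0⟩ : ∃ R : ℝ, ρ ≤ R ∧ H.d c y < R ∧ 0 < R :=
    ⟨max ρ (H.d c y + 1), le_max_left _ _, lt_of_lt_of_le (by linarith) (le_max_right _ _),
      lt_of_lt_of_le (by linarith [H.d_nonneg c y]) (le_max_right _ _)⟩
  set E := H.ball c R with hE
  have hcE : c ∈ E := H.mem_ball_self hR0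
  have hyE : y ∈ E := hRy
  set good : 𝒟.Idx → Prop := fun Q => E ⊆ H.ball (𝒟.mid Q) (2 * cd * (C₀ * δ ^ 𝒟.gen Q)) with hgood
  have hcoarse : ∀ s, ∃ K : ℤ, ∀ k ≤ K, good (𝒟.cubeAt k s) := by
    intro s
    have hlim : ∃ n : ℕ, cd * (H.d s c + R) < C₀ * δ⁻¹ ^ n := by
      obtain ⟨n, hn⟩ := pow_unbounded_of_one_lt (cd * (H.d s c + R) / C₀) ((one_lt_inv₀ hδ).2 hδ1)
      exact ⟨n, by rw [div_lt_iff₀ hC] at hn; linarith⟩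
    obtain ⟨n, hn⟩ := hlim
    refine ⟨-n, fun k hk x hx => ?_⟩
    have h1 : C₀ * δ⁻¹ ^ n ≤ C₀ * δ ^ k := by
      rw [inv_pow, ← zpow_natCast, ← zpow_neg]
      exact mul_le_mul_of_nonneg_left (zpow_le_zpow_right_of_le_one₀ hδ hδ1.le hk) hC.le
    have h2 := 𝒟.carrier_subset_ball _ (𝒟.mem_cubeAt k s)
    change H.d (𝒟.mid (𝒟.cubeAt k s)) s < C₀ * δ ^ k at h2
    change H.d (𝒟.mid (𝒟.cubeAt k s)) x < 2 * cd * (C₀ * δ ^ k)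
    have hx' : H.d c x < R := hx
    have h3 := H.d_triangle s x c
    have h4 := H.d_triangle (𝒟.mid (𝒟.cubeAt k s)) x s
    have h5 : H.d s x < C₀ * δ ^ k := by
      refine h3.trans_lt (lt_of_le_of_lt ?_ (hn.trans_le h1))
      gcongr
    calc _ ≤ _ := h4
      _ < cd * (C₀ * δ ^ k + C₀ * δ ^ k) :=
        mul_lt_mul_of_pos_left (by linarith) (by linarith)
      _ = _ := by ring
  have hfine : ∀ s, ∃ k : ℤ, ¬ good (𝒟.cubeAt k s) := by
    intro s
    have hd : 0 < H.d c y := lt_of_le_of_ne (H.d_nonneg c y) fun h =>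
      hy ((H.d_eq_zero_iff c y).1 h.symm).symm
    obtain ⟨n, hn⟩ := exists_pow_lt_of_lt_one (y := δ) (x := H.d c y / (4 * cd ^ 2 * C₀))
      (by positivity) hδ1
    refine ⟨n, fun hg => ?_⟩
    have h1 : H.d (𝒟.mid (𝒟.cubeAt n s)) c < 2 * cd * (C₀ * δ ^ (n : ℤ)) := hg hcE
    have h2 : H.d (𝒟.mid (𝒟.cubeAt n s)) y < 2 * cd * (C₀ * δ ^ (n : ℤ)) := hg hyE
    rw [zpow_natCast] at h1 h2
    rw [lt_div_iff₀ (by positivity)] at hn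
    have h3 := H.d_triangle c y (𝒟.mid (𝒟.cubeAt n s))
    rw [H.d_symm c (𝒟.mid _)] at h3
    have h4 : cd * (H.d (𝒟.mid (𝒟.cubeAt n s)) c + H.d (𝒟.mid (𝒟.cubeAt n s)) y) <
        cd * (2 * cd * (C₀ * δ ^ n) + 2 * cd * (C₀ * δ ^ n)) :=
      mul_lt_mul_of_pos_left (by linarith) (by linarith)
    nlinarith
  -- The roots are the coarsest bad cubes. Badness makes them stop at a finite generation; goodness
  -- of the parent puts the ball inside the dilation.
  refine ⟨{Q | ¬ good Q ∧ ∀ P, 𝒟.gen P < 𝒟.gen Q → 𝒟.carrier Q ⊆ 𝒟.carrier P → good P},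
    ?_, ?_, ?_⟩
  · rintro P ⟨hP1, hP2⟩ Q ⟨hQ1, hQ2⟩ s hsP hsQ
    rcases lt_trichotomy (𝒟.gen P) (𝒟.gen Q) with h | h | h
    · exact absurd (hQ2 P h (𝒟.carrier_subset_of_le h.le hsQ hsP)) hP1
    · exact 𝒟.eq_of_gen_eq h hsP hsQ
    · exact absurd (hP2 Q h (𝒟.carrier_subset_of_le h.le hsP hsQ)) hQ1
  · intro s
    obtain ⟨K, hK⟩ := hcoarse s
    obtain ⟨k, hk, hmin⟩ := Int.exists_least_of_bdd (P := fun k => ¬ good (𝒟.cubeAt k s))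
      ⟨K, fun k hk => not_lt.1 fun h => hk (hK k h.le)⟩ (hfine s)
    refine ⟨𝒟.cubeAt k s, ⟨hk, fun P hP hsub => ?_⟩, 𝒟.mem_cubeAt k s⟩
    by_contra hbad
    rw [← 𝒟.cubeAt_eq (hsub (𝒟.mem_cubeAt k s))] at hbad
    exact absurd (hmin _ hbad) (not_le.2 hP)
  · rintro Q ⟨-, hQ⟩
    set z := 𝒟.mid Q
    have hzQ := 𝒟.mid_mem hc hδ Q
    set P := 𝒟.cubeAt (𝒟.gen Q - 1) z
    have hzP : z ∈ 𝒟.carrier P := 𝒟.mem_cubeAt _ z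
    have hgP : 𝒟.gen P = 𝒟.gen Q - 1 := rfl
    have hP := hQ P (by omega) (𝒟.carrier_subset_of_le (by omega) hzQ hzP)
    intro x hx
    have h1 : H.d (𝒟.mid P) x < 2 * cd * (C₀ * δ ^ 𝒟.gen P) := hP (H.ball_subset_ball c hRρ hx)
    have h2 : H.d (𝒟.mid P) z < C₀ * δ ^ 𝒟.gen P := 𝒟.carrier_subset_ball P hzP
    have h3 := H.d_triangle z x (𝒟.mid P)
    rw [H.d_symm z (𝒟.mid P)] at h3
    have h5 : δ ^ 𝒟.gen Q = δ ^ 𝒟.gen P * δ := by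
      rw [← zpow_add_one₀ hδ.ne', hgP, sub_add_cancel]
    have h6 := hpow (𝒟.gen P)
    change H.d z x < α * (C₀ * δ ^ 𝒟.gen Q)
    calc H.d z x ≤ cd * (H.d (𝒟.mid P) z + H.d (𝒟.mid P) x) := h3
      _ < cd * (C₀ * δ ^ 𝒟.gen P + 2 * cd * (C₀ * δ ^ 𝒟.gen P)) :=
        mul_lt_mul_of_pos_left (by linarith) (by linarith)
      _ = (cd + 2 * cd ^ 2) * (C₀ * δ ^ 𝒟.gen P) := by ring
      -- Here `α ≥ 3 cd² / δ` is used: `cd + 2 cd² ≤ 3 cd²`, and the factor `δ` is lost between the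
      -- parent and `Q`.
      _ ≤ (α * δ) * (C₀ * δ ^ 𝒟.gen P) := by gcongr; nlinarith
      _ = _ := by rw [h5]; ring

/-! ### Lebesgue density by martingale convergence -/

section Density

theorem measurable_index (hc : 0 < c₀) (hδ : 0 < δ) (k : ℤ) :
    Measurable[mS, ⊤] (𝒟.index k) := by
  have := 𝒟.countable_J hc hδ k
  let _ : MeasurableSpace (𝒟.J k) := ⊤
  refine measurable_to_countable' fun j => ?_
  have : 𝒟.index k ⁻¹' {j} = 𝒟.cube k j := by
    ext s; exact 𝒟.mem_cube_iff.symm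
  rw [this]
  exact 𝒟.measurable_cube k j

/-- The filtration generated by the cubes of the generations `K, K + 1, …`. -/
def filtration (hc : 0 < c₀) (hδ : 0 < δ) (K : ℤ) : Filtration ℕ mS where
  seq n := MeasurableSpace.comap (𝒟.index (K + n)) ⊤
  mono' := by
    intro n n' hnn
    rintro A ⟨B, -, rfl⟩
    refine ⟨{j | ∃ s, 𝒟.index (K + n') s = j ∧ 𝒟.index (K + n) s ∈ B}, trivial, ?_⟩
    ext s
    constructor
    · rintro ⟨t, hts, htB⟩
      change 𝒟.index (K + n) s ∈ B
      rwa [← 𝒟.index_eq_of_le (by omega) hts]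
    · intro hs
      exact ⟨s, rfl, hs⟩
  le' n := (𝒟.measurable_index hc hδ _).comap_le

/-- Cube diameters tend to zero, so an open `U` is the union over `n` of the cubes of generation `K
+ n` contained in `U`. -/
theorem iSup_filtration (hcd : 1 ≤ cd) (hc : 0 < c₀) (hC : 0 < C₀) (hδ : 0 < δ) (hδ1 : δ < 1)
    (K : ℤ) : ⨆ n, 𝒟.filtration hc hδ K n = mS := by
  refine le_antisymm (iSup_le fun n => (𝒟.filtration hc hδ K).le n) ?_
  conv_lhs => rw [H.borel_eq]
  refine MeasurableSpace.generateFrom_le fun U hU => ?_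
  have hunion : U = ⋃ n : ℕ, {s | 𝒟.carrier (𝒟.cubeAt (K + n) s) ⊆ U} := by
    ext s
    rw [Set.mem_iUnion]
    constructor
    · intro hs
      obtain ⟨ρ, hρ, hρU⟩ := hU s hs
      obtain ⟨n, hn⟩ := exists_pow_lt_of_lt_one (y := δ) (x := ρ / (2 * cd * C₀ * δ ^ K))
        (by have := zpow_pos hδ K; positivity) hδ1
      refine ⟨n, fun x hx => hρU ?_⟩
      have h1 := 𝒟.carrier_subset_ball _ hx
      have h2 := 𝒟.carrier_subset_ball _ (𝒟.mem_cubeAt (K + n) s)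
      rw [HomogeneousSpace.mem_ball] at h1 h2
      have h3 := H.d_triangle s x (𝒟.mid (𝒟.cubeAt (K + n) s))
      rw [H.d_symm s (𝒟.mid (𝒟.cubeAt (K + n) s))] at h3
      rw [lt_div_iff₀ (by have := zpow_pos hδ K; positivity)] at hn
      change H.d s x < ρ
      calc _ ≤ _ := h3
        _ ≤ cd * (C₀ * δ ^ (K + n) + C₀ * δ ^ (K + n)) :=
          mul_le_mul_of_nonneg_left (add_le_add h2.le h1.le) (by linarith)
        _ = δ ^ n * (2 * cd * C₀ * δ ^ K) := by
          rw [zpow_add₀ hδ.ne', zpow_natCast]; ring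
        _ < ρ := hn
    · rintro ⟨n, hn⟩
      exact hn (𝒟.mem_cubeAt _ s)
  rw [hunion]
  refine MeasurableSet.iUnion fun n => ?_
  refine (le_iSup (fun n => (𝒟.filtration hc hδ K n)) n) _ ?_
  exact ⟨{j | 𝒟.cube (K + n) j ⊆ U}, trivial, rfl⟩

/-- A dyadic form of the Lebesgue density theorem. -/
theorem ae_exists_density (hcd : 1 ≤ cd) (hc : 0 < c₀) (hC : 0 < C₀) (hδ : 0 < δ) (hδ1 : δ < 1)
    {Ω : Set S} (hΩ : MeasurableSet Ω) {θ : ℝ≥0∞} (hθ : θ < 1) (K : ℤ) :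
    ∀ᵐ s ∂μ, s ∈ Ω → ∃ k, K ≤ k ∧
      θ * μ (𝒟.carrier (𝒟.cubeAt k s)) < μ (𝒟.carrier (𝒟.cubeAt k s) ∩ Ω) := by
  have := 𝒟.countable_J hc hδ K
  have hloc : ∀ p : S → Prop, (∀ j, ∀ᵐ s ∂μ.restrict (𝒟.cube K j), p s) → ∀ᵐ s ∂μ, p s := by
    intro p hp
    rwa [← ae_restrict_iUnion_iff, 𝒟.iUnion_cube K, Measure.restrict_univ] at hp
  refine hloc _ fun j => ?_
  set ν := μ.restrict (𝒟.cube K j) with hν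
  have hfin : IsFiniteMeasure ν := by
    refine ⟨?_⟩
    rw [hν, Measure.restrict_apply_univ]
    exact 𝒟.measure_carrier_lt_top hC hδ ⟨K, j⟩
  set ℱ := 𝒟.filtration hc hδ K
  have hint : Integrable (Ω.indicator fun _ => (1 : ℝ)) ν :=
    (integrable_const 1).indicator hΩ
  -- On a cube of generation `K + n` inside `cube K j`, the conditional expectation is constant and
  -- equals the density of `Ω` there; it tends to `1` at almost every point of `Ω`. Working in one
  -- cube of generation `K` makes the measure finite.
  have hlim := tendsto_ae_condExp (μ := ν) (ℱ := ℱ) (Ω.indicator fun _ => (1 : ℝ))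
  rw [show (⨆ n, ℱ n) = mS from 𝒟.iSup_filtration hcd hc hC hδ hδ1 K] at hlim
  rw [condExp_of_stronglyMeasurable le_rfl
    (stronglyMeasurable_const.indicator hΩ) hint] at hlim
  filter_upwards [hlim, ae_restrict_mem (𝒟.measurable_cube K j)] with s hs hsj hsΩ
  rw [Set.indicator_of_mem hsΩ] at hs
  have hθ' : θ.toReal < 1 := by
    rw [← ENNReal.toReal_one]
    exact (ENNReal.toReal_lt_toReal hθ.ne_top ENNReal.one_ne_top).2 hθ
  obtain ⟨n, hn⟩ := (hs.eventually (lt_mem_nhds hθ')).exists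
  refine ⟨K + n, by omega, ?_⟩
  set P := 𝒟.carrier (𝒟.cubeAt (K + n) s) with hP
  have hPm : MeasurableSet[ℱ n] P := by
    refine ⟨{𝒟.index (K + n) s}, trivial, ?_⟩
    ext t
    exact 𝒟.mem_cube_iff.symm
  have hPK : P ⊆ 𝒟.cube K j :=
    𝒟.carrier_subset_of_le (P := 𝒟.cubeAt (K + n) s) (Q := ⟨K, j⟩) (show K ≤ K + n by omega)
      (𝒟.mem_cubeAt _ s) hsj
  have hconst : ∀ t ∈ P, (ν[Ω.indicator fun _ => (1 : ℝ)|ℱ n]) t =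
      (ν[Ω.indicator fun _ => (1 : ℝ)|ℱ n]) s := by
    intro t ht
    have hm : MeasurableSet[ℱ n] ((ν[Ω.indicator fun _ => (1 : ℝ)|ℱ n]) ⁻¹'
        {(ν[Ω.indicator fun _ => (1 : ℝ)|ℱ n]) s}) :=
      (stronglyMeasurable_condExp (μ := ν) (m := ℱ n)).measurable (measurableSet_singleton _)
    obtain ⟨B, -, hB⟩ := hm
    have h1 : s ∈ 𝒟.index (K + n) ⁻¹' B := by rw [hB]; rfl
    have h2 : t ∈ 𝒟.index (K + n) ⁻¹' B := by
      rw [Set.mem_preimage, 𝒟.index_eq (k := K + n) ht]; exact h1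
    rw [hB] at h2
    exact h2
  have hPm' : MeasurableSet P := 𝒟.measurableSet_carrier _
  have hset := setIntegral_condExp (μ := ν) (ℱ.le n) hint hPm
  rw [setIntegral_congr_fun hPm' hconst, setIntegral_const, integral_indicator_const _ hΩ] at hset
  simp only [smul_eq_mul, mul_one] at hset
  have e1 : ν P = μ P := by
    rw [hν, Measure.restrict_apply hPm', Set.inter_eq_left.2 hPK]
  have e2 : (ν.restrict P) Ω = μ (P ∩ Ω) := by
    rw [Measure.restrict_apply hΩ, hν, Measure.restrict_apply (hΩ.inter hPm')]
    congr 1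
    ext t
    exact ⟨fun h => ⟨h.1.2, h.1.1⟩, fun h => ⟨⟨h.2, h.1⟩, hPK h.1⟩⟩
  rw [measureReal_def, measureReal_def, e1, e2] at hset
  have hP0 : 0 < μ P := 𝒟.measure_carrier_pos hc hδ _
  have hPtop : μ P < ∞ := 𝒟.measure_carrier_lt_top hC hδ _
  have hpos : 0 < (μ P).toReal := ENNReal.toReal_pos hP0.ne' hPtop.ne
  have hlt : θ.toReal * (μ P).toReal < (μ (P ∩ Ω)).toReal := by
    rw [← hset, mul_comm]
    exact mul_lt_mul_of_pos_left hn hpos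
  rw [← ENNReal.toReal_mul] at hlt
  exact (ENNReal.toReal_lt_toReal (ENNReal.mul_ne_top hθ.ne_top hPtop.ne)
    ((measure_mono Set.inter_subset_left).trans_lt hPtop).ne).1 hlt

end Density

/-! ### Stopping cubes -/

section Stopping

/-- The maximal cubes in `Q`, at least `N` generations below `Q`, in which the set `Ω` has density
greater than `θ`. -/
def stoppingChildren (N : ℕ) (θ : ℝ≥0∞) (Ω : Set S) (Q : 𝒟.Idx) : Set 𝒟.Idx :=
  {P | 𝒟.gen Q + N ≤ 𝒟.gen P ∧ 𝒟.carrier P ⊆ 𝒟.carrier Q ∧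
    θ * μ (𝒟.carrier P) < μ (𝒟.carrier P ∩ Ω) ∧
    ∀ R, 𝒟.gen Q + N ≤ 𝒟.gen R → 𝒟.gen R < 𝒟.gen P → 𝒟.carrier P ⊆ 𝒟.carrier R →
      μ (𝒟.carrier R ∩ Ω) ≤ θ * μ (𝒟.carrier R)}

variable {𝒟} {N : ℕ} {θ : ℝ≥0∞} {Ω : Set S} {Q : 𝒟.Idx}

theorem eq_of_mem_stoppingChildren {P P' : 𝒟.Idx} (hP : P ∈ 𝒟.stoppingChildren N θ Ω Q)
    (hP' : P' ∈ 𝒟.stoppingChildren N θ Ω Q) {s : S} (hs : s ∈ 𝒟.carrier P)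
    (hs' : s ∈ 𝒟.carrier P') : P = P' := by
  rcases lt_trichotomy (𝒟.gen P) (𝒟.gen P') with h | h | h
  · exact absurd hP.2.2.1
      (not_lt.2 (hP'.2.2.2 P hP.1 h (𝒟.carrier_subset_of_le h.le hs' hs)))
  · exact 𝒟.eq_of_gen_eq h hs hs'
  · exact absurd hP'.2.2.1
      (not_lt.2 (hP.2.2.2 P' hP'.1 h (𝒟.carrier_subset_of_le h.le hs hs')))

theorem ae_mem_stoppingChildren (hcd : 1 ≤ cd) (hc : 0 < c₀) (hC : 0 < C₀) (hδ : 0 < δ)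
    (hδ1 : δ < 1) (hΩ : MeasurableSet Ω) (hθ : θ < 1) :
    ∀ᵐ s ∂μ, s ∈ 𝒟.carrier Q → s ∈ Ω → ∃ P ∈ 𝒟.stoppingChildren N θ Ω Q, s ∈ 𝒟.carrier P := by
  filter_upwards [𝒟.ae_exists_density hcd hc hC hδ hδ1 hΩ hθ (𝒟.gen Q + N)] with s hs hsQ hsΩ
  obtain ⟨k, ⟨hk, hdens⟩, hmin⟩ := Int.exists_least_of_bdd
    (P := fun k => 𝒟.gen Q + N ≤ k ∧
      θ * μ (𝒟.carrier (𝒟.cubeAt k s)) < μ (𝒟.carrier (𝒟.cubeAt k s) ∩ Ω))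
    ⟨𝒟.gen Q + N, fun k hk => hk.1⟩ (hs hsΩ)
  refine ⟨𝒟.cubeAt k s, ⟨hk, ?_, hdens, fun R hR hRk hsub => ?_⟩, 𝒟.mem_cubeAt k s⟩
  · exact 𝒟.carrier_subset_of_le (show 𝒟.gen Q ≤ k by omega) (𝒟.mem_cubeAt k s) hsQ
  · by_contra! hlt
    rw [← 𝒟.cubeAt_eq (hsub (𝒟.mem_cubeAt k s))] at hlt
    exact absurd (hmin _ ⟨hR, hlt⟩) (not_le.2 hRk)

theorem mul_tsum_stoppingChildren_le (hc : 0 < c₀) (hδ : 0 < δ) (hΩ : MeasurableSet Ω) :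
    θ * ∑' P : 𝒟.stoppingChildren N θ Ω Q, μ (𝒟.carrier P) ≤ μ Ω := by
  have := 𝒟.countable_Idx hc hδ
  rw [← ENNReal.tsum_mul_left]
  calc ∑' P : 𝒟.stoppingChildren N θ Ω Q, θ * μ (𝒟.carrier P)
      ≤ ∑' P : 𝒟.stoppingChildren N θ Ω Q, μ (𝒟.carrier P ∩ Ω) :=
        ENNReal.tsum_le_tsum fun P => P.2.2.2.1.le
    _ = μ (⋃ P : 𝒟.stoppingChildren N θ Ω Q, 𝒟.carrier P ∩ Ω) := by
        refine (measure_iUnion (fun P P' hPP => ?_)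
          fun P => (𝒟.measurableSet_carrier _).inter hΩ).symm
        refine Set.disjoint_left.2 fun s hs hs' => hPP (Subtype.ext ?_)
        exact eq_of_mem_stoppingChildren P.2 P'.2 hs.1 hs'.1
    _ ≤ μ Ω := measure_mono (Set.iUnion_subset fun P => Set.inter_subset_right)

/-- By maximality the cube one generation above `P` has density at most `θ`, and its measure is
comparable to that of `P`. If `P` sits exactly `N` generations below `Q`, that cube is no candidate,
and `Q` itself with the hypothesis on `μ Ω` takes its place. -/
theorem measure_stoppingChild_inter_le (hcd : 1 ≤ cd) (hc : 0 < c₀) (hC : 0 < C₀) (hδ : 0 < δ)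
    (hδ1 : δ < 1) (hN : 1 ≤ N) (hΩ : μ Ω ≤ θ * μ (𝒟.carrier Q)) {P : 𝒟.Idx}
    (hP : P ∈ 𝒟.stoppingChildren N θ Ω Q) :
    μ (𝒟.carrier P ∩ Ω) ≤
      θ * (doublingConst cμ (2 * cd * C₀ / (c₀ * δ ^ N)) * μ (𝒟.carrier P)) := by
  rcases hP.1.lt_or_eq with h | h
  · set z := 𝒟.mid P
    have hz := 𝒟.mid_mem hc hδ P
    set R := 𝒟.cubeAt (𝒟.gen P - 1) z
    have hgR : 𝒟.gen R = 𝒟.gen P - 1 := rfl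
    have hPR : 𝒟.carrier P ⊆ 𝒟.carrier R :=
      𝒟.carrier_subset_of_le (by omega) hz (𝒟.mem_cubeAt _ z)
    calc μ (𝒟.carrier P ∩ Ω) ≤ μ (𝒟.carrier R ∩ Ω) := by gcongr
      _ ≤ θ * μ (𝒟.carrier R) := hP.2.2.2 R (by omega) (by omega) hPR
      _ ≤ _ := by
        gcongr
        exact 𝒟.measure_carrier_le_of_subset hcd hc hC hδ hδ1 hPR (by omega)
  · calc μ (𝒟.carrier P ∩ Ω) ≤ μ Ω := measure_mono Set.inter_subset_right
      _ ≤ θ * μ (𝒟.carrier Q) := hΩ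
      _ ≤ _ := by
        gcongr
        exact 𝒟.measure_carrier_le_of_subset hcd hc hC hδ hδ1 hP.2.1 (by omega)

end Stopping

/-! ### The tree generated by the children -/

section Tree

variable (child : 𝒟.Idx → Set 𝒟.Idx)

/-- The descendants of `Q` of order `n`. -/
def descendants : ℕ → 𝒟.Idx → Set 𝒟.Idx
  | 0, Q => {Q}
  | n + 1, Q => ⋃ P ∈ child Q, descendants n P

/-- The part of a cube outside its children. -/
def core (Q : 𝒟.Idx) : Set S := 𝒟.carrier Q \ ⋃ P ∈ child Q, 𝒟.carrier P

variable {child}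

theorem carrier_subset_of_mem_descendants
    (hsub : ∀ Q, ∀ P ∈ child Q, 𝒟.carrier P ⊆ 𝒟.carrier Q) {n : ℕ} {P Q : 𝒟.Idx}
    (hP : P ∈ 𝒟.descendants child n Q) : 𝒟.carrier P ⊆ 𝒟.carrier Q := by
  induction n generalizing Q with
  | zero => rw [show P = Q from hP]
  | succ n ih =>
    obtain ⟨R, hR, hPR⟩ := Set.mem_iUnion₂.1 hP
    exact (ih hPR).trans (hsub Q R hR)

/-- The two lines of descent from `Q` pass through the same child as long as both continue, and
neither can end first, since a point of a core lies in no child. -/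
theorem eq_of_mem_core (hsub : ∀ Q, ∀ P ∈ child Q, 𝒟.carrier P ⊆ 𝒟.carrier Q)
    (huniq : ∀ Q, ∀ P ∈ child Q, ∀ P' ∈ child Q, ∀ s ∈ 𝒟.carrier P, s ∈ 𝒟.carrier P' → P = P')
    {n n' : ℕ} {P P' Q : 𝒟.Idx} (hP : P ∈ 𝒟.descendants child n Q)
    (hP' : P' ∈ 𝒟.descendants child n' Q) {s : S} (hs : s ∈ 𝒟.core child P)
    (hs' : s ∈ 𝒟.core child P') : P = P' := by
  induction n generalizing n' Q with
  | zero =>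
    obtain rfl : P = Q := hP
    cases n' with
    | zero => exact (show P' = P from hP').symm
    | succ n' =>
      obtain ⟨R, hR, hPR⟩ := Set.mem_iUnion₂.1 hP'
      exact absurd (Set.mem_iUnion₂.2
        ⟨R, hR, 𝒟.carrier_subset_of_mem_descendants hsub hPR hs'.1⟩) hs.2
  | succ n ih =>
    obtain ⟨R, hR, hPR⟩ := Set.mem_iUnion₂.1 hP
    have hsR := 𝒟.carrier_subset_of_mem_descendants hsub hPR hs.1
    cases n' with
    | zero =>
      obtain rfl : P' = Q := hP'
      exact absurd (Set.mem_iUnion₂.2 ⟨R, hR, hsR⟩) hs'.2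
    | succ n' =>
      obtain ⟨R', hR', hPR'⟩ := Set.mem_iUnion₂.1 hP'
      have hsR' := 𝒟.carrier_subset_of_mem_descendants hsub hPR' hs'.1
      obtain rfl := huniq Q R hR R' hR' s hsR hsR'
      exact ih hPR hPR'

theorem measure_descendants_le (hc : 0 < c₀) (hδ : 0 < δ)
    (hhalf : ∀ Q, ∑' P : child Q, μ (𝒟.carrier P) ≤ 2⁻¹ * μ (𝒟.carrier Q)) (n : ℕ) (Q : 𝒟.Idx) :
    μ (⋃ P ∈ 𝒟.descendants child n Q, 𝒟.carrier P) ≤ 2⁻¹ ^ n * μ (𝒟.carrier Q) := by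
  have := 𝒟.countable_Idx hc hδ
  induction n generalizing Q with
  | zero => simp [descendants]
  | succ n ih =>
    have : (⋃ P ∈ 𝒟.descendants child (n + 1) Q, 𝒟.carrier P) ⊆
        ⋃ R : child Q, ⋃ P ∈ 𝒟.descendants child n R, 𝒟.carrier P := by
      refine Set.iUnion₂_subset fun P hP => ?_
      obtain ⟨R, hR, hPR⟩ := Set.mem_iUnion₂.1 hP
      exact fun s hs => Set.mem_iUnion.2 ⟨⟨R, hR⟩, Set.mem_iUnion₂.2 ⟨P, hPR, hs⟩⟩
    calc _ ≤ μ (⋃ R : child Q, ⋃ P ∈ 𝒟.descendants child n R, 𝒟.carrier P) := measure_mono this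
      _ ≤ ∑' R : child Q, μ (⋃ P ∈ 𝒟.descendants child n R, 𝒟.carrier P) := measure_iUnion_le _
      _ ≤ ∑' R : child Q, 2⁻¹ ^ n * μ (𝒟.carrier R) := ENNReal.tsum_le_tsum fun R => ih R
      _ = 2⁻¹ ^ n * ∑' R : child Q, μ (𝒟.carrier R) := ENNReal.tsum_mul_left
      _ ≤ 2⁻¹ ^ n * (2⁻¹ * μ (𝒟.carrier Q)) := by gcongr; exact hhalf Q
      _ = _ := by rw [pow_succ, mul_assoc]

theorem ae_exists_notMem_descendants (hc : 0 < c₀) (hC : 0 < C₀) (hδ : 0 < δ)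
    (hhalf : ∀ Q, ∑' P : child Q, μ (𝒟.carrier P) ≤ 2⁻¹ * μ (𝒟.carrier Q)) (Q : 𝒟.Idx) :
    ∀ᵐ s ∂μ, ∃ n, s ∉ ⋃ P ∈ 𝒟.descendants child n Q, 𝒟.carrier P := by
  rw [ae_iff]
  push Not
  refine le_antisymm ?_ bot_le
  have hlim : Tendsto (fun n : ℕ => (2⁻¹ : ℝ≥0∞) ^ n * μ (𝒟.carrier Q)) atTop (𝓝 0) := by
    have h := ENNReal.tendsto_pow_atTop_nhds_zero_of_lt_one (r := 2⁻¹) (by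
      rw [ENNReal.inv_lt_one]; exact ENNReal.one_lt_two)
    simpa using ENNReal.Tendsto.mul_const h
      (Or.inr (𝒟.measure_carrier_lt_top hC hδ Q).ne)
  refine ge_of_tendsto' hlim fun n => ?_
  exact (measure_mono fun s (hs : ∀ n, s ∈ ⋃ P ∈ 𝒟.descendants child n Q, 𝒟.carrier P) => hs n).trans (𝒟.measure_descendants_le hc hδ hhalf n Q)

/-- Follow the child containing `s` until there is none; `hn` bounds the number of steps. Freezing
`q` after `m` makes the chain depend on finitely many cubes, so that later only countably many
chains occur. -/
theorem exists_chain {n : ℕ} {Q : 𝒟.Idx} {s : S} (hs : s ∈ 𝒟.carrier Q)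
    (hn : s ∉ ⋃ P ∈ 𝒟.descendants child n Q, 𝒟.carrier P) :
    ∃ (m : ℕ) (q : ℕ → 𝒟.Idx), q 0 = Q ∧ (∀ i < m, q (i + 1) ∈ child (q i)) ∧
      (∀ i ≤ m, q i ∈ 𝒟.descendants child i Q) ∧ (∀ i, m ≤ i → q i = q m) ∧
      s ∈ 𝒟.core child (q m) := by
  induction n generalizing Q with
  | zero =>
    exact absurd (Set.mem_iUnion₂.2
      ⟨Q, show Q ∈ 𝒟.descendants child 0 Q from Set.mem_singleton Q, hs⟩) hn
  | succ n ih =>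
    by_cases h : ∃ P ∈ child Q, s ∈ 𝒟.carrier P
    · obtain ⟨P, hP, hsP⟩ := h
      obtain ⟨m, q, h0, h1, h2, h3, h4⟩ := ih hsP (fun hcon => hn (by
        obtain ⟨R, hR, hsR⟩ := Set.mem_iUnion₂.1 hcon
        exact Set.mem_iUnion₂.2 ⟨R, Set.mem_iUnion₂.2 ⟨P, hP, hR⟩, hsR⟩))
      refine ⟨m + 1, fun i => Nat.casesOn i Q q, rfl, ?_, ?_, ?_, h4⟩
      · intro i hi
        cases i with
        | zero => change q 0 ∈ child Q; rwa [h0]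
        | succ i => exact h1 i (by omega)
      · intro i hi
        cases i with
        | zero => exact rfl
        | succ i => exact Set.mem_iUnion₂.2 ⟨P, hP, h2 i (by omega)⟩
      · intro i hi
        obtain ⟨i, rfl⟩ : ∃ j, i = j + 1 := ⟨i - 1, by omega⟩
        exact h3 i (by omega)
    · refine ⟨0, fun _ => Q, rfl, fun i hi => absurd hi (by omega), fun i hi => ?_,
        fun _ _ => rfl, hs, fun hcon => h ?_⟩
      · obtain rfl : i = 0 := by omega
        exact rfl
      · obtain ⟨P, hP, hsP⟩ := Set.mem_iUnion₂.1 hcon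
        exact ⟨P, hP, hsP⟩

end Tree

end DyadicSystem

/-! ### Weak-type estimates -/

section WeakType

variable {S : Type u} [MeasurableSpace S] {μ : Measure S}

theorem weakNorm_le_weakOpNorm_mul {X : Type v} [NormedAddCommGroup X] {p : ℝ≥0∞} {q : ℝ}
    {A : Lp X p μ → S → ℝ≥0∞} (hA : weakOpNorm q A < ∞) (f : Lp X p μ) :
    weakNorm μ q (A f) ≤ weakOpNorm q A * eLpNorm f p μ := by
  obtain ⟨C, hC⟩ : {C : ℝ≥0∞ | ∀ f : Lp X p μ, weakNorm μ q (A f) ≤ C * eLpNorm f p μ}.Nonempty := by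
    by_contra h
    rw [Set.not_nonempty_iff_eq_empty] at h
    rw [weakOpNorm, h, sInf_empty] at hA
    exact lt_irrefl _ hA
  by_cases h0 : eLpNorm f p μ = 0
  · have := hC f
    rw [h0, mul_zero] at this ⊢
    exact this
  · have htop : eLpNorm f p μ ≠ ∞ := (Lp.memLp f).2.ne
    rw [← ENNReal.div_le_iff h0 htop]
    refine le_sInf fun C hC => ?_
    rw [ENNReal.div_le_iff h0 htop]
    exact hC f

/-- The weak bound gains `Λ^(-q)`, which is at most `Λ⁻¹` as `q ≥ 1`. Hence `Λ` can be fixed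
independently of `q`. -/
theorem measure_lt_of_weakNorm_le {q : ℝ} (hq : 1 ≤ q) {g : S → ℝ≥0∞} {b V Λ : ℝ≥0∞}
    (hg : weakNorm μ q g ≤ b) (hb : b ≠ ∞) (hV0 : V ≠ 0) (hV : V ≠ ∞) (hΛ1 : 1 ≤ Λ) (hΛ : Λ ≠ ∞) :
    μ {s | Λ * b * V ^ (-(1 / q)) < g s} ≤ Λ⁻¹ * V := by
  have hq0 : 0 < q := by linarith
  have hΛ0 : Λ ≠ 0 := (zero_lt_one.trans_le hΛ1).ne'
  have key : ∀ t : ℝ≥0, (t : ℝ≥0∞) * μ {s | (t : ℝ≥0∞) < g s} ^ (1 / q) ≤ b :=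
    fun t => (le_iSup (fun t : ℝ≥0 => (t : ℝ≥0∞) * μ {s | (t : ℝ≥0∞) < g s} ^ (1 / q)) t).trans hg
  -- For `b = 0` the level is zero, and testing at that level says nothing; positive levels exhaust
  -- `{0 < g}` instead.
  rcases eq_or_ne b 0 with rfl | hb0
  · have hnull : ∀ n : ℕ, μ {s | (((n + 1 : ℝ≥0)⁻¹ : ℝ≥0) : ℝ≥0∞) < g s} = 0 := by
      intro n
      have h := key (n + 1 : ℝ≥0)⁻¹
      rw [nonpos_iff_eq_zero, mul_eq_zero] at h
      rcases h with h | h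
      · exact absurd (ENNReal.coe_eq_zero.1 h) (by positivity)
      · exact (ENNReal.rpow_eq_zero_iff_of_pos (by positivity)).1 h
    have : {s | Λ * 0 * V ^ (-(1 / q)) < g s} ⊆
        ⋃ n : ℕ, {s | (((n + 1 : ℝ≥0)⁻¹ : ℝ≥0) : ℝ≥0∞) < g s} := by
      intro s hs
      have hs : 0 < g s := by simpa using hs
      obtain ⟨n, hn⟩ := ENNReal.exists_inv_nat_lt hs.ne'
      refine Set.mem_iUnion.2 ⟨n, lt_of_le_of_lt ?_ hn⟩
      rw [ENNReal.coe_inv (by positivity)]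
      gcongr
      push_cast
      exact le_self_add
    refine (measure_mono this).trans ?_
    rw [measure_iUnion_null hnull]
    exact zero_le
  · have ht : Λ * b * V ^ (-(1 / q)) ≠ ∞ :=
      ENNReal.mul_ne_top (ENNReal.mul_ne_top hΛ hb) (ENNReal.rpow_ne_top_of_ne_zero hV0 hV)
    have h := key (Λ * b * V ^ (-(1 / q))).toNNReal
    rw [ENNReal.coe_toNNReal ht] at h
    set m := μ {s | Λ * b * V ^ (-(1 / q)) < g s} with hm
    have hVq0 : V ^ (1 / q) ≠ 0 := by
      rw [Ne, ENNReal.rpow_eq_zero_iff_of_pos (by positivity)]; exact hV0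
    have hVq : V ^ (1 / q) ≠ ∞ := ENNReal.rpow_ne_top_of_nonneg (by positivity) hV
    have h1 : Λ * m ^ (1 / q) ≤ V ^ (1 / q) := by
      rw [ENNReal.rpow_neg] at h
      have h2 : b * (Λ * m ^ (1 / q) * (V ^ (1 / q))⁻¹) ≤ b * 1 := by
        rw [mul_one]; refine le_trans (le_of_eq ?_) h; ring
      have h3 := (ENNReal.mul_le_mul_iff_right hb0 hb).1 h2
      rwa [← div_eq_mul_inv, ENNReal.div_le_iff hVq0 hVq, one_mul] at h3
    have h4 := ENNReal.rpow_le_rpow h1 hq0.le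
    rw [ENNReal.mul_rpow_of_nonneg _ _ hq0.le, ← ENNReal.rpow_mul, ← ENNReal.rpow_mul,
      one_div_mul_cancel hq0.ne', ENNReal.rpow_one, ENNReal.rpow_one] at h4
    have h5 : Λ ≤ Λ ^ q := by
      conv_lhs => rw [← ENNReal.rpow_one Λ]
      exact ENNReal.rpow_le_rpow_of_exponent_le hΛ1 hq
    rw [mul_comm, ← div_eq_mul_inv, ENNReal.le_div_iff_mul_le (Or.inl hΛ0) (Or.inl hΛ), mul_comm]
    exact (mul_le_mul_left h5 m).trans h4

end WeakType

/-! ### Truncations, telescoping and oscillation -/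

section Restriction

variable {S : Type u} [MeasurableSpace S] {μ : Measure S}
  {X : Type v} [NormedAddCommGroup X] {p : ℝ≥0∞}

theorem coeFn_indicatorLp {A : Set S} (hA : MeasurableSet A) (f : Lp X p μ) :
    indicatorLp hA f =ᵐ[μ] A.indicator f := MemLp.coeFn_toLp _

theorem eLpNorm_indicatorLp {p₀ : ℝ} (hp : 1 ≤ p₀) {A : Set S} (hA : MeasurableSet A)
    (f : Lp X (ENNReal.ofReal p₀) μ) :
    eLpNorm (indicatorLp hA f) (ENNReal.ofReal p₀) μ = (∫⁻ x in A, ‖f x‖ₑ ^ p₀ ∂μ) ^ (1 / p₀) := by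
  have hp0 : ENNReal.ofReal p₀ ≠ 0 := by
    rw [Ne, ENNReal.ofReal_eq_zero]; linarith
  rw [eLpNorm_congr_ae (coeFn_indicatorLp hA f), eLpNorm_indicator_eq_eLpNorm_restrict hA,
    eLpNorm_eq_lintegral_rpow_enorm_toReal hp0 ENNReal.ofReal_ne_top,
    ENNReal.toReal_ofReal (by linarith)]

theorem sub_indicatorLp {A B : Set S} (hA : MeasurableSet A) (hB : MeasurableSet B) (hBA : B ⊆ A)
    (f : Lp X p μ) :
    indicatorLp hA f - indicatorLp hB f = indicatorLp hB.compl (indicatorLp hA f) := by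
  refine Lp.ext ?_
  filter_upwards [Lp.coeFn_sub (indicatorLp hA f) (indicatorLp hB f), coeFn_indicatorLp hA f,
    coeFn_indicatorLp hB f, coeFn_indicatorLp hB.compl (indicatorLp hA f)] with s h1 h2 h3 h4
  rw [h1, h4, Pi.sub_apply, h2, h3]
  by_cases hsB : s ∈ B
  · simp [hsB, hBA hsB]
  · rw [Set.indicator_of_notMem hsB, Set.indicator_of_mem (show s ∈ Bᶜ from hsB), sub_zero, h2]

theorem indicatorLp_eq_self {A : Set S} (hA : MeasurableSet A) {f : Lp X p μ}
    (hf : ∀ᵐ s ∂μ, s ∉ A → f s = 0) : indicatorLp hA f = f := by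
  refine Lp.ext ?_
  filter_upwards [coeFn_indicatorLp hA f, hf] with s h1 h2
  rw [h1]
  by_cases hs : s ∈ A
  · rw [Set.indicator_of_mem hs]
  · rw [Set.indicator_of_notMem hs, h2 hs]

variable {cd cμ : ℝ} {H : HomogeneousSpace μ cd cμ} {Y : Type w} [NormedAddCommGroup Y]

/-- An `r`-sublinear operator applied to a telescoping sum of truncations to decreasing balls. -/
theorem IsSublinearWith.enorm_telescope_le {r Cr : ℝ} (hr : 1 ≤ r) (hCr : 0 < Cr)
    {T : Lp X p μ → (S →ₘ[μ] Y)} (hT : IsSublinearWith H r Cr T) (f : Lp X p μ) (m : ℕ)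
    (c : ℕ → S) (ρ : ℕ → ℝ)
    (hsub : ∀ i < m, H.ball (c (i + 1)) (ρ (i + 1)) ⊆ H.ball (c i) (ρ i)) :
    ∀ᵐ s ∂μ, ‖T (indicatorLp (H.measurableSet_ball (c 0) (ρ 0)) f) s‖ₑ ≤ ENNReal.ofReal Cr *
      (∑ i ∈ Finset.range m, ‖T (indicatorLp (H.measurableSet_ball (c i) (ρ i)) f -
          indicatorLp (H.measurableSet_ball (c (i + 1)) (ρ (i + 1))) f) s‖ₑ ^ r +
        ‖T (indicatorLp (H.measurableSet_ball (c m) (ρ m)) f) s‖ₑ ^ r) ^ (1 / r) := by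
  set R : ℕ → Lp X p μ := fun i => indicatorLp (H.measurableSet_ball (c i) (ρ i)) f with hR
  -- The pieces live on the disjoint differences of consecutive balls, and `F m` on the innermost
  -- ball.
  set F : ℕ → Lp X p μ := fun i => if i < m then R i - R (i + 1) else R i with hF
  have hanti : ∀ i j, i ≤ j → j ≤ m → H.ball (c j) (ρ j) ⊆ H.ball (c i) (ρ i) := by
    intro i j hij
    induction j, hij using Nat.le_induction with
    | base => exact fun _ => subset_rfl
    | succ j hij ih => exact fun hj => (hsub j (by omega)).trans (ih (by omega))
  have hFae : ∀ i, ∀ᵐ s ∂μ, F i s = if i < m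
      then (H.ball (c i) (ρ i)).indicator f s - (H.ball (c (i + 1)) (ρ (i + 1))).indicator f s
      else (H.ball (c i) (ρ i)).indicator f s := by
    intro i
    by_cases hi : i < m
    · filter_upwards [Lp.coeFn_sub (R i) (R (i + 1)),
        coeFn_indicatorLp (H.measurableSet_ball (c i) (ρ i)) f,
        coeFn_indicatorLp (H.measurableSet_ball (c (i + 1)) (ρ (i + 1))) f] with s h1 h2 h3
      simp only [hF, hi, if_true]
      rw [h1, Pi.sub_apply, h2, h3]
    · filter_upwards [coeFn_indicatorLp (H.measurableSet_ball (c i) (ρ i)) f] with s h2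
      simp only [hF, hi, if_false]
      exact h2
  have hzero : ∀ i ≤ m, ∀ᵐ s ∂μ, s ∉ H.ball (c i) (ρ i) → F i s = 0 := by
    intro i hi
    filter_upwards [hFae i] with s h1 hs
    rw [h1]
    split_ifs with him
    · rw [Set.indicator_of_notMem hs, Set.indicator_of_notMem fun h => hs (hsub i him h), sub_zero]
    · rw [Set.indicator_of_notMem hs]
  have hdisj : ∀ i j, i < j → j ≤ m → ∀ᵐ s ∂μ, F i s = 0 ∨ F j s = 0 := by
    intro i j hij hj
    filter_upwards [hFae i, hzero j hj] with s h1 h2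
    by_cases hs : s ∈ H.ball (c j) (ρ j)
    · left
      have hs1 := hanti (i + 1) j hij hj hs
      rw [h1, if_pos (by omega), Set.indicator_of_mem (hsub i (by omega) hs1),
        Set.indicator_of_mem hs1, sub_self]
    · exact Or.inr (h2 hs)
  have hsum : ∑ i : Fin (m + 1), F i = R 0 := by
    rw [Fin.sum_univ_eq_sum_range (fun i => F i), Finset.sum_range_succ]
    have : ∑ i ∈ Finset.range m, F i = ∑ i ∈ Finset.range m, (R i - R (i + 1)) :=
      Finset.sum_congr rfl fun i hi => if_pos (Finset.mem_range.1 hi)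
    rw [this, Finset.sum_range_sub']
    simp [hF]
  have h := hT (m + 1) (fun i => F i)
    (fun i => ⟨c i, ρ i, hzero i (by omega)⟩)
    (fun i j hij => by
      rcases lt_or_gt_of_ne (fun h => hij (Fin.ext h) : (i : ℕ) ≠ j) with h | h
      · exact hdisj i j h (by omega)
      · exact (hdisj j i h (by omega)).mono fun s => Or.symm)
  rw [hsum] at h
  filter_upwards [h] with s hs
  have hr0 : 0 ≤ 1 / r := by positivity
  rw [Fin.sum_univ_eq_sum_range (fun i => ‖T (F i) s‖ ^ r), Finset.sum_range_succ] at hs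
  have hs2 : ∑ i ∈ Finset.range m, ‖T (F i) s‖ ^ r =
      ∑ i ∈ Finset.range m, ‖T (R i - R (i + 1)) s‖ ^ r :=
    Finset.sum_congr rfl fun i hi => by rw [hF]; simp only [if_pos (Finset.mem_range.1 hi)]
  rw [hs2, show F m = R m by simp [hF]] at hs
  have hnn : ∀ y : Y, 0 ≤ ‖y‖ ^ r := fun y => Real.rpow_nonneg (norm_nonneg _) _
  have hpow : ∀ y : Y, ENNReal.ofReal (‖y‖ ^ r) = ‖y‖ₑ ^ r := fun y => by
    rw [← ENNReal.ofReal_rpow_of_nonneg (norm_nonneg _) (by linarith), ofReal_norm]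
  have hs3 := ENNReal.ofReal_le_ofReal hs
  rw [ofReal_norm, ENNReal.ofReal_mul hCr.le, ← ENNReal.ofReal_rpow_of_nonneg
    (add_nonneg (Finset.sum_nonneg fun i _ => hnn _) (hnn _)) hr0,
    ENNReal.ofReal_add (Finset.sum_nonneg fun i _ => hnn _) (hnn _),
    ENNReal.ofReal_sum_of_nonneg fun i _ => hnn _] at hs3
  simpa only [hpow] using hs3

/-- The oscillation of `T(f 1_{S ∖ αB})` on `B`, together with one point where `T(f 1_{S ∖ αB})` is
under control, bounds it on `B`. -/
theorem ae_enorm_le_of_sharpMaximal_le [SFinite μ] {α : ℝ} {T : Lp X p μ → (S →ₘ[μ] Y)}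
    {f : Lp X p μ} {c : S} {ρ : ℝ} (hρ : 0 < ρ) {U : Set S} (hU : U ⊆ H.ball c ρ)
    {a b : ℝ≥0∞} {G : Set S} (hGU : G ⊆ U) (hG : μ G ≠ 0)
    (hGM : ∀ s ∈ G, sharpMaximal H α T f s ≤ a)
    (hGT : ∀ᵐ s ∂μ, s ∈ G →
      ‖T (indicatorLp (H.measurableSet_ball c (α * ρ)).compl f) s‖ₑ ≤ b) :
    ∀ᵐ s ∂μ, s ∈ U → ‖T (indicatorLp (H.measurableSet_ball c (α * ρ)).compl f) s‖ₑ ≤ a + b := by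
  set g := T (indicatorLp (H.measurableSet_ball c (α * ρ)).compl f) with hg
  set ν := μ.restrict (H.ball c ρ) with hν
  obtain ⟨s₀, hs₀⟩ : G.Nonempty := by
    by_contra h
    rw [Set.not_nonempty_iff_eq_empty] at h
    exact hG (by rw [h, measure_empty])
  have hess : essSup (fun y : S × S => ‖g y.1 - g y.2‖ₑ) (ν.prod ν) ≤ a := by
    refine le_trans ?_ (hGM s₀ hs₀)
    exact le_iSup_of_le c (le_iSup_of_le ρ (le_iSup_of_le hρ
      (le_iSup_of_le (hU (hGU hs₀)) le_rfl)))
  have h1 : ∀ᵐ y ∂ν.prod ν, ‖g y.1 - g y.2‖ₑ ≤ a :=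
    (ENNReal.ae_le_essSup _).mono fun y hy => hy.trans hess
  have h2 := Measure.ae_ae_of_ae_prod h1
  rw [hν, ae_restrict_iff' (H.measurableSet_ball c ρ)] at h2
  -- By Fubini almost every `x` has almost every partner `y` within `a`; since `G` is not null, such
  -- an `x` exists in `G` with `‖g x‖ₑ ≤ b` as well.
  obtain ⟨x, hxG, hx⟩ : ∃ x ∈ G, (x ∈ H.ball c ρ → ∀ᵐ y ∂ν, ‖g x - g y‖ₑ ≤ a) ∧
      (x ∈ G → ‖g x‖ₑ ≤ b) := by
    by_contra! hcon
    refine hG (measure_mono_null ?_ (ae_iff.1 (h2.and hGT)))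
    intro x hx hx2
    exact absurd (hx2.2 hx) (not_le.2 (hcon x hx hx2.1).2)
  have h3 := hx.1 (hU (hGU hxG))
  rw [hν, ae_restrict_iff' (H.measurableSet_ball c ρ)] at h3
  filter_upwards [h3] with s hs hsU
  calc ‖g s‖ₑ = ‖(g s - g x) + g x‖ₑ := by rw [sub_add_cancel]
    _ ≤ ‖g s - g x‖ₑ + ‖g x‖ₑ := enorm_add_le _ _
    _ ≤ a + b := add_le_add (by rw [enorm_sub_rev]; exact hs (hU hsU)) (hx.2 hxG)

end Restriction

/-! ### The stopping-time argument for the operator -/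

namespace DyadicSystem

variable {S : Type u} [MeasurableSpace S] {μ : Measure S} {cd cμ : ℝ}
  {H : HomogeneousSpace μ cd cμ} {c₀ C₀ δ : ℝ} (𝒟 : DyadicSystem H c₀ C₀ δ)
  {X : Type v} [NormedAddCommGroup X] {Y : Type w} [NormedAddCommGroup Y]
  {p₀ q₀ α : ℝ} {Λ W θ : ℝ≥0∞} {N : ℕ}

/-- The truncation `f 1_{αQ}`. -/
def truncate (α : ℝ) {p : ℝ≥0∞} (f : Lp X p μ) (Q : 𝒟.Idx) : Lp X p μ :=
  indicatorLp (𝒟.measurableSet_dilation α Q) f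

/-- The level `Λ W μ(αQ)^{-1/q₀} ‖f 1_{αQ}‖_{p₀}` of the stopping condition in the cube `Q`. -/
def level (α p₀ q₀ : ℝ) (Λ W : ℝ≥0∞) (f : S → X) (Q : 𝒟.Idx) : ℝ≥0∞ :=
  Λ * (W * (∫⁻ x in 𝒟.dilation α Q, ‖f x‖ₑ ^ p₀ ∂μ) ^ (1 / p₀)) *
    μ (𝒟.dilation α Q) ^ (-(1 / q₀))

/-- A measurable hull of the set where `T(f 1_{αQ})` or its sharp maximal function exceeds the
level of `Q`. -/
def exceptional (T : Lp X (ENNReal.ofReal p₀) μ → (S →ₘ[μ] Y)) (α q₀ : ℝ) (Λ W : ℝ≥0∞)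
    (f : Lp X (ENNReal.ofReal p₀) μ) (Q : 𝒟.Idx) : Set S :=
  toMeasurable μ ({s | 𝒟.level α p₀ q₀ Λ W f Q < ‖T (𝒟.truncate α f Q) s‖ₑ} ∪
    {s | 𝒟.level α p₀ q₀ Λ W f Q < sharpMaximal H α T (𝒟.truncate α f Q) s})

variable {𝒟} {T : Lp X (ENNReal.ofReal p₀) μ → (S →ₘ[μ] Y)} {f : Lp X (ENNReal.ofReal p₀) μ}

theorem enorm_le_level_of_notMem_exceptional {Q : 𝒟.Idx} {s : S}
    (hs : s ∉ 𝒟.exceptional T α q₀ Λ W f Q) :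
    ‖T (𝒟.truncate α f Q) s‖ₑ ≤ 𝒟.level α p₀ q₀ Λ W f Q :=
  not_lt.1 fun h => hs (subset_toMeasurable _ _ (Or.inl h))

theorem sharpMaximal_le_level_of_notMem_exceptional {Q : 𝒟.Idx} {s : S}
    (hs : s ∉ 𝒟.exceptional T α q₀ Λ W f Q) :
    sharpMaximal H α T (𝒟.truncate α f Q) s ≤ 𝒟.level α p₀ q₀ Λ W f Q :=
  not_lt.1 fun h => hs (subset_toMeasurable _ _ (Or.inr h))

theorem measure_exceptional_le (hp : 1 ≤ p₀) (hq : 1 ≤ q₀) (hc : 0 < c₀) (hC : 0 < C₀) (hδ : 0 < δ)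
    (hα : 0 < α) (hT : weakOpNorm q₀ (fun f s => ‖T f s‖ₑ) ≤ W)
    (hM : weakOpNorm q₀ (sharpMaximal H α T) ≤ W) (hW : W < ∞) (hΛ1 : 1 ≤ Λ) (hΛ : Λ ≠ ∞)
    (Q : 𝒟.Idx) :
    μ (𝒟.exceptional T α q₀ Λ W f Q) ≤
      2 * Λ⁻¹ * doublingConst cμ (α * C₀ / c₀) * μ (𝒟.carrier Q) := by
  have hV0 := (𝒟.measure_dilation_pos hC hδ hα Q).ne'
  have hV := (𝒟.measure_dilation_lt_top hC hδ hα Q).ne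
  have hnorm := eLpNorm_indicatorLp hp (𝒟.measurableSet_dilation α Q) f
  have hfin : W * (∫⁻ x in 𝒟.dilation α Q, ‖f x‖ₑ ^ p₀ ∂μ) ^ (1 / p₀) ≠ ∞ := by
    rw [← hnorm]
    exact ENNReal.mul_ne_top hW.ne (Lp.memLp _).2.ne
  have h1 := measure_lt_of_weakNorm_le hq
    ((weakNorm_le_weakOpNorm_mul (hT.trans_lt hW) (𝒟.truncate α f Q)).trans
      (by rw [truncate, hnorm]; exact mul_le_mul_left hT _)) hfin hV0 hV hΛ1 hΛ
  have h2 := measure_lt_of_weakNorm_le hq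
    ((weakNorm_le_weakOpNorm_mul (hM.trans_lt hW) (𝒟.truncate α f Q)).trans
      (by rw [truncate, hnorm]; exact mul_le_mul_left hM _)) hfin hV0 hV hΛ1 hΛ
  rw [exceptional, measure_toMeasurable]
  calc _ ≤ Λ⁻¹ * μ (𝒟.dilation α Q) + Λ⁻¹ * μ (𝒟.dilation α Q) :=
        (measure_union_le _ _).trans (add_le_add h1 h2)
    _ = 2 * Λ⁻¹ * μ (𝒟.dilation α Q) := by ring
    _ ≤ 2 * Λ⁻¹ * (doublingConst cμ (α * C₀ / c₀) * μ (𝒟.carrier Q)) := by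
        gcongr; exact 𝒟.measure_dilation_le hc hδ α Q
    _ = _ := by ring

theorem measure_carrier_le_two_mul_core (hc : 0 < c₀) (hC : 0 < C₀) (hδ : 0 < δ)
    {child : 𝒟.Idx → Set 𝒟.Idx}
    (hhalf : ∀ Q, ∑' P : child Q, μ (𝒟.carrier P) ≤ 2⁻¹ * μ (𝒟.carrier Q)) (Q : 𝒟.Idx) :
    μ (𝒟.carrier Q) ≤ 2 * μ (𝒟.core child Q) := by
  have := 𝒟.countable_Idx hc hδ
  have htop := (𝒟.measure_carrier_lt_top hC hδ Q).ne
  have h1 : μ (𝒟.carrier Q) ≤ μ (𝒟.core child Q) + 2⁻¹ * μ (𝒟.carrier Q) := by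
    calc μ (𝒟.carrier Q) ≤ μ (𝒟.core child Q ∪ ⋃ P : child Q, 𝒟.carrier P) := by
          refine measure_mono fun s hs => ?_
          by_cases h : s ∈ ⋃ P ∈ child Q, 𝒟.carrier P
          · right
            obtain ⟨P, hP, hsP⟩ := Set.mem_iUnion₂.1 h
            exact Set.mem_iUnion.2 ⟨⟨P, hP⟩, hsP⟩
          · exact Or.inl ⟨hs, h⟩
      _ ≤ μ (𝒟.core child Q) + ∑' P : child Q, μ (𝒟.carrier P) :=
          (measure_union_le _ _).trans (by gcongr; exact measure_iUnion_le _)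
      _ ≤ _ := by gcongr; exact hhalf Q
  have h2 : 2⁻¹ * μ (𝒟.carrier Q) + 2⁻¹ * μ (𝒟.carrier Q) = μ (𝒟.carrier Q) := by
    rw [← add_mul, ENNReal.inv_two_add_inv_two, one_mul]
  have h3 : 2⁻¹ * μ (𝒟.carrier Q) ≤ μ (𝒟.core child Q) := by
    have hne : 2⁻¹ * μ (𝒟.carrier Q) ≠ ∞ := ENNReal.mul_ne_top (by simp) htop
    exact (ENNReal.add_le_add_iff_right hne).1 (h2.le.trans h1)
  calc μ (𝒟.carrier Q) = 2 * (2⁻¹ * μ (𝒟.carrier Q)) := by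
        rw [← mul_assoc, ENNReal.mul_inv_cancel two_ne_zero ENNReal.ofNat_ne_top, one_mul]
    _ ≤ _ := by gcongr

theorem measurableSet_core (hc : 0 < c₀) (hδ : 0 < δ) (child : 𝒟.Idx → Set 𝒟.Idx) (Q : 𝒟.Idx) :
    MeasurableSet (𝒟.core child Q) := by
  have := 𝒟.countable_Idx hc hδ
  exact (𝒟.measurableSet_carrier Q).diff
    (MeasurableSet.biUnion (Set.to_countable _) fun P _ => 𝒟.measurableSet_carrier P)

/-- The increment of `T` between a cube and a stopping child is controlled by their levels. -/
theorem ae_enorm_increment_le (hcd : 1 ≤ cd) (hc : 0 < c₀) (hC : 0 < C₀) (hδ : 0 < δ)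
    (hδ1 : δ < 1) (hα : 3 * cd ≤ α) (hN : 1 ≤ N) (hNδ : cd * δ ^ N ≤ 2 / 3)
    (hsubT : ∀ g h, T (g - h) = T g - T h)
    (hθ : θ * doublingConst cμ (2 * cd * C₀ / (c₀ * δ ^ N)) ≤ 4⁻¹) (hθ1 : θ ≤ 4⁻¹)
    (hΩ : ∀ Q, μ (𝒟.exceptional T α q₀ Λ W f Q) ≤ θ * μ (𝒟.carrier Q)) {P Q : 𝒟.Idx}
    (hP : P ∈ 𝒟.stoppingChildren N θ (𝒟.exceptional T α q₀ Λ W f Q) Q) :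
    ∀ᵐ s ∂μ, s ∈ 𝒟.carrier P → ‖T (𝒟.truncate α f Q - 𝒟.truncate α f P) s‖ₑ ≤
      𝒟.level α p₀ q₀ Λ W f Q + (𝒟.level α p₀ q₀ Λ W f Q + 𝒟.level α p₀ q₀ Λ W f P) := by
  have := H.sigmaFinite
  have hsub := 𝒟.dilation_subset_dilation hcd hc hC hδ hδ1 hα hNδ hP.2.1 hP.1
  have heq := sub_indicatorLp (𝒟.measurableSet_dilation α Q) (𝒟.measurableSet_dilation α P) hsub f
  set ΩQ := 𝒟.exceptional T α q₀ Λ W f Q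
  set ΩP := 𝒟.exceptional T α q₀ Λ W f P
  set G := 𝒟.carrier P \ (ΩQ ∪ ΩP) with hG
  have hP0 := 𝒟.measure_carrier_pos hc hδ P
  have hPt := (𝒟.measure_carrier_lt_top hC hδ P).ne
  -- Each of `P ∩ ΩQ` and `ΩP` has at most a quarter of the measure of `P`.
  have hGpos : μ G ≠ 0 := by
    intro h0
    have h1 : μ (𝒟.carrier P) ≤ 4⁻¹ * μ (𝒟.carrier P) + 4⁻¹ * μ (𝒟.carrier P) := by
      calc μ (𝒟.carrier P) ≤ μ (G ∪ (𝒟.carrier P ∩ ΩQ ∪ ΩP)) := by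
            refine measure_mono fun s hs => ?_
            by_cases h1 : s ∈ ΩQ
            · exact Or.inr (Or.inl ⟨hs, h1⟩)
            by_cases h2 : s ∈ ΩP
            · exact Or.inr (Or.inr h2)
            exact Or.inl ⟨hs, fun h => h.elim h1 h2⟩
        _ ≤ μ G + (μ (𝒟.carrier P ∩ ΩQ) + μ ΩP) :=
            (measure_union_le _ _).trans (by gcongr; exact measure_union_le _ _)
        _ = μ (𝒟.carrier P ∩ ΩQ) + μ ΩP := by rw [h0, zero_add]
        _ ≤ _ := by
            refine add_le_add ?_ ((hΩ P).trans (by gcongr))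
            refine (measure_stoppingChild_inter_le hcd hc hC hδ hδ1 hN (hΩ Q) hP).trans ?_
            rw [← mul_assoc]
            gcongr
    have h2 : (4⁻¹ + 4⁻¹ : ℝ≥0∞) < 1 := by
      rw [← ENNReal.inv_two_add_inv_two]
      have : (4⁻¹ : ℝ≥0∞) < 2⁻¹ := ENNReal.inv_lt_inv.2 (by norm_num)
      exact ENNReal.add_lt_add this this
    rw [← add_mul] at h1
    refine absurd h1 (not_le.2 ?_)
    calc _ < 1 * μ (𝒟.carrier P) := ENNReal.mul_lt_mul_left hP0.ne' hPt h2
      _ = _ := one_mul _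
  have hTG : ∀ᵐ s ∂μ, s ∈ G → ‖T (𝒟.truncate α f Q - 𝒟.truncate α f P) s‖ₑ ≤
      𝒟.level α p₀ q₀ Λ W f Q + 𝒟.level α p₀ q₀ Λ W f P := by
    rw [hsubT]
    filter_upwards [AEEqFun.coeFn_sub (T (𝒟.truncate α f Q)) (T (𝒟.truncate α f P))] with s hs hsG
    rw [hs, Pi.sub_apply]
    exact enorm_sub_le.trans (add_le_add
      (enorm_le_level_of_notMem_exceptional fun h => hsG.2 (Or.inl h))
      (enorm_le_level_of_notMem_exceptional fun h => hsG.2 (Or.inr h)))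
  unfold truncate at hTG ⊢
  -- Now `f 1_{αQ} - f 1_{αP}` is `f 1_{αQ}` cut off outside `αB`, where `B ⊇ P` is the outer ball
  -- of `P` and `αB = αP`. This is a truncation seen by the sharp maximal function of `f 1_{αQ}` on
  -- `P`.
  rw [heq] at hTG ⊢
  exact ae_enorm_le_of_sharpMaximal_le (mul_pos hC (zpow_pos hδ _)) (𝒟.carrier_subset_ball P)
    (Set.sdiff_subset) hGpos
    (fun s hs => sharpMaximal_le_level_of_notMem_exceptional fun h => hs.2 (Or.inl h)) hTG

/-- Domination of `Tf` along chains of stopping cubes. -/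
theorem exists_chain_domination (hcd : 1 ≤ cd) (hcμ : 1 ≤ cμ) (hc : 0 < c₀) (hC : 0 < C₀) (hδ : 0 < δ)
    (hδ1 : δ < 1) (hα : 3 * cd ≤ α) (hN : 1 ≤ N) (hNδ : cd * δ ^ N ≤ 2 / 3)
    (hsubT : ∀ g h, T (g - h) = T g - T h) {r Cr : ℝ} (hr : 1 ≤ r) (hCr : 0 < Cr)
    (hT : IsSublinearWith H r Cr T)
    (hθ : θ = (4 * doublingConst cμ (2 * cd * C₀ / (c₀ * δ ^ N)))⁻¹)
    (hΩ : ∀ Q, μ (𝒟.exceptional T α q₀ Λ W f Q) ≤ 2⁻¹ * θ * μ (𝒟.carrier Q))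
    {roots : Set 𝒟.Idx}
    (huniq : ∀ P ∈ roots, ∀ Q ∈ roots, ∀ s ∈ 𝒟.carrier P, s ∈ 𝒟.carrier Q → P = Q)
    (hcover : ∀ s, ∃ Q ∈ roots, s ∈ 𝒟.carrier Q)
    (hsupp : ∀ Q ∈ roots, ∀ᵐ s ∂μ, s ∉ 𝒟.dilation α Q → f s = 0) :
    ∃ (stops : Set 𝒟.Idx) (E : 𝒟.Idx → Set S),
      (∀ Q ∈ stops, MeasurableSet (E Q) ∧ E Q ⊆ 𝒟.carrier Q ∧ μ (𝒟.carrier Q) ≤ 2 * μ (E Q)) ∧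
      (∀ P ∈ stops, ∀ Q ∈ stops, P ≠ Q → Disjoint (E P) (E Q)) ∧
      ∀ᵐ s ∂μ, ∃ (m : ℕ) (q : ℕ → 𝒟.Idx), (∀ i ≤ m, q i ∈ stops ∧ s ∈ 𝒟.carrier (q i)) ∧
        (∀ i < m, 𝒟.gen (q i) < 𝒟.gen (q (i + 1))) ∧
        ‖T f s‖ₑ ≤ ENNReal.ofReal Cr * (2 * (3 ^ r *
          ∑ i ∈ Finset.range (m + 1), 𝒟.level α p₀ q₀ Λ W f (q i) ^ r)) ^ (1 / r) := by
  have := 𝒟.countable_Idx hc hδ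
  have hr0 : 0 < r := by linarith
  set K := doublingConst cμ (2 * cd * C₀ / (c₀ * δ ^ N)) with hK
  have hK1 : 1 ≤ K := one_le_doublingConst hcμ _
  have hKt : K ≠ ∞ := doublingConst_ne_top _ _
  have hK0 : K ≠ 0 := (zero_lt_one.trans_le hK1).ne'
  have hθ0 : θ ≠ 0 := by
    rw [hθ, Ne, ENNReal.inv_eq_zero]; exact ENNReal.mul_ne_top (by simp) hKt
  have hθ4 : θ = 4⁻¹ * K⁻¹ := by
    rw [hθ, ENNReal.mul_inv (Or.inl (by simp)) (Or.inl (by simp))]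
  have hθ1 : θ ≤ 4⁻¹ := by
    rw [hθ4]
    exact mul_le_of_le_one_right' (ENNReal.inv_le_one.2 hK1)
  have hθK : θ * K ≤ 4⁻¹ := by
    rw [hθ4, mul_assoc, ENNReal.inv_mul_cancel hK0 hKt, mul_one]
  have hθlt : θ < 1 := hθ1.trans_lt (ENNReal.inv_lt_one.2 (by norm_num))
  have hθt : θ ≠ ∞ := hθlt.ne_top
  set child : 𝒟.Idx → Set 𝒟.Idx :=
    fun Q => 𝒟.stoppingChildren N θ (𝒟.exceptional T α q₀ Λ W f Q) Q with hchild
  have hΩ' : ∀ Q, μ (𝒟.exceptional T α q₀ Λ W f Q) ≤ θ * μ (𝒟.carrier Q) := fun Q => by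
    refine (hΩ Q).trans ?_
    gcongr
    exact mul_le_of_le_one_left' (ENNReal.inv_le_one.2 (by norm_num))
  have hsub : ∀ Q, ∀ P ∈ child Q, 𝒟.carrier P ⊆ 𝒟.carrier Q := fun Q P hP => hP.2.1
  have hchild_uniq : ∀ Q, ∀ P ∈ child Q, ∀ P' ∈ child Q, ∀ s ∈ 𝒟.carrier P, s ∈ 𝒟.carrier P' →
      P = P' := fun Q P hP P' hP' s hs hs' => eq_of_mem_stoppingChildren hP hP' hs hs'
  have hhalf : ∀ Q, ∑' P : child Q, μ (𝒟.carrier P) ≤ 2⁻¹ * μ (𝒟.carrier Q) := by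
    intro Q
    have h := (mul_tsum_stoppingChildren_le (N := N) (θ := θ) (Q := Q) hc hδ
      (measurableSet_toMeasurable _ _)).trans (hΩ Q)
    rw [show 2⁻¹ * θ * μ (𝒟.carrier Q) = θ * (2⁻¹ * μ (𝒟.carrier Q)) by ring] at h
    exact (ENNReal.mul_le_mul_iff_right hθ0 hθt).1 h
  refine ⟨{Q | ∃ R ∈ roots, ∃ n, Q ∈ 𝒟.descendants child n R}, 𝒟.core child,
    fun Q _ => ⟨measurableSet_core hc hδ child Q, Set.sdiff_subset,
      measure_carrier_le_two_mul_core hc hC hδ hhalf Q⟩, ?_, ?_⟩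
  · rintro P ⟨R, hR, n, hPR⟩ Q ⟨R', hR', n', hQR'⟩ hPQ
    refine Set.disjoint_left.2 fun s hs hs' => hPQ ?_
    obtain rfl := huniq R hR R' hR' s (𝒟.carrier_subset_of_mem_descendants hsub hPR hs.1)
      (𝒟.carrier_subset_of_mem_descendants hsub hQR' hs'.1)
    exact 𝒟.eq_of_mem_core hsub hchild_uniq hPR hQR' hs hs'
  · have hfin : ∀ᵐ s ∂μ, ∀ Q, ∃ n, s ∉ ⋃ P ∈ 𝒟.descendants child n Q, 𝒟.carrier P :=
      ae_all_iff.2 fun Q => 𝒟.ae_exists_notMem_descendants hc hC hδ hhalf Q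
    -- The children cover almost all of the exceptional set inside `Q`, so the core avoids it up to
    -- a null set.
    have hcore : ∀ᵐ s ∂μ, ∀ Q, s ∈ 𝒟.core child Q →
        ‖T (𝒟.truncate α f Q) s‖ₑ ≤ 𝒟.level α p₀ q₀ Λ W f Q := by
      refine ae_all_iff.2 fun Q => ?_
      filter_upwards [ae_mem_stoppingChildren (Q := Q) (N := N) hcd hc hC hδ hδ1
        (measurableSet_toMeasurable μ _) hθlt] with s hs hsQ
      refine enorm_le_level_of_notMem_exceptional fun hsΩ => hsQ.2 ?_
      obtain ⟨P, hP, hsP⟩ := hs hsQ.1 hsΩ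
      exact Set.mem_iUnion₂.2 ⟨P, hP, hsP⟩
    have hincr : ∀ᵐ s ∂μ, ∀ Q P, P ∈ child Q → s ∈ 𝒟.carrier P →
        ‖T (𝒟.truncate α f Q - 𝒟.truncate α f P) s‖ₑ ≤ 𝒟.level α p₀ q₀ Λ W f Q +
          (𝒟.level α p₀ q₀ Λ W f Q + 𝒟.level α p₀ q₀ Λ W f P) := by
      refine ae_all_iff.2 fun Q => ae_all_iff.2 fun P => ?_
      by_cases hP : P ∈ child Q
      · exact (ae_enorm_increment_le hcd hc hC hδ hδ1 hα hN hNδ hsubT hθK hθ1 hΩ' hP).mono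
          fun s hs _ => hs
      · exact Filter.Eventually.of_forall fun s h => absurd h hP
    -- The null set in the telescoping estimate depends on the chain, while the chain depends on
    -- `s`. Coding chains by `Fin (m + 1) → 𝒟.Idx` leaves a countable union of null sets.
    have htel : ∀ᵐ s ∂μ, ∀ (m : ℕ) (v : Fin (m + 1) → 𝒟.Idx), ∀ q : ℕ → 𝒟.Idx,
        q = (fun i => v ⟨min i m, by omega⟩) → (∀ i < m, q (i + 1) ∈ child (q i)) →
        ‖T (𝒟.truncate α f (q 0)) s‖ₑ ≤ ENNReal.ofReal Cr *
          (∑ i ∈ Finset.range m, ‖T (𝒟.truncate α f (q i) - 𝒟.truncate α f (q (i + 1))) s‖ₑ ^ r +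
            ‖T (𝒟.truncate α f (q m)) s‖ₑ ^ r) ^ (1 / r) := by
      refine ae_all_iff.2 fun m => ae_all_iff.2 fun v => ?_
      set q : ℕ → 𝒟.Idx := fun i => v ⟨min i m, by omega⟩ with hq
      by_cases hch : ∀ i < m, q (i + 1) ∈ child (q i)
      · filter_upwards [hT.enorm_telescope_le hr hCr f m (fun i => 𝒟.mid (q i))
          (fun i => α * (C₀ * δ ^ 𝒟.gen (q i))) (fun i hi =>
            𝒟.dilation_subset_dilation hcd hc hC hδ hδ1 hα hNδ (hch i hi).2.1 (hch i hi).1)]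
          with s hs q' hq' _
        rw [hq']
        exact hs
      · refine Filter.Eventually.of_forall fun s q' hq' h => absurd ?_ hch
        rwa [hq'] at h
    filter_upwards [hfin, hcore, hincr, htel] with s hfin hcore hincr htel
    obtain ⟨R, hR, hsR⟩ := hcover s
    obtain ⟨n, hn⟩ := hfin R
    obtain ⟨m, q, h0, h1, h2, h3, h4⟩ := 𝒟.exists_chain hsR hn
    have hmem : ∀ i ≤ m, s ∈ 𝒟.carrier (q i) := by
      intro i hi
      induction hi using Nat.decreasingInduction with
      | self => exact h4.1
      | of_succ i hi ih => exact hsub _ _ (h1 i hi) ih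
    refine ⟨m, q, fun i hi => ⟨⟨R, hR, i, h2 i hi⟩, hmem i hi⟩, fun i hi => ?_, ?_⟩
    · have := (h1 i hi).1
      omega
    have hroot : 𝒟.truncate α f (q 0) = f := by
      rw [h0]; exact indicatorLp_eq_self _ (hsupp R hR)
    have hq := htel m (fun j => q j) q (by
      funext i
      rcases le_total i m with h | h
      · simp [h]
      · simp [h, h3 i h]) h1
    rw [hroot] at hq
    refine hq.trans ?_
    set l : ℕ → ℝ≥0∞ := fun i => 𝒟.level α p₀ q₀ Λ W f (q i) with hl
    have hpow3 : ∀ x y z : ℝ≥0∞, x ≤ y + (y + z) → x ^ r ≤ 3 ^ r * (y ^ r + z ^ r) := by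
      intro x y z hx
      have h5 : x ≤ 3 * max y z := by
        refine hx.trans ?_
        calc y + (y + z) ≤ max y z + (max y z + max y z) :=
              add_le_add (le_max_left _ _) (add_le_add (le_max_left _ _) (le_max_right _ _))
          _ = 3 * max y z := by ring
      refine (ENNReal.rpow_le_rpow h5 hr0.le).trans ?_
      rw [ENNReal.mul_rpow_of_nonneg _ _ hr0.le]
      gcongr
      rcases le_total y z with h | h
      · rw [max_eq_right h]; exact le_add_self
      · rw [max_eq_left h]; exact le_self_add
    have hA : ∑ i ∈ Finset.range m,
        ‖T (𝒟.truncate α f (q i) - 𝒟.truncate α f (q (i + 1))) s‖ₑ ^ r ≤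
        ∑ i ∈ Finset.range m, 3 ^ r * (l i ^ r + l (i + 1) ^ r) := by
      refine Finset.sum_le_sum fun i hi => hpow3 _ _ _ ?_
      have hi := Finset.mem_range.1 hi
      exact hincr _ _ (h1 i hi) (hmem (i + 1) hi)
    have hB : ‖T (𝒟.truncate α f (q m)) s‖ₑ ^ r ≤ 3 ^ r * (l m ^ r + 0) := by
      have := hpow3 (‖T (𝒟.truncate α f (q m)) s‖ₑ) (l m) 0
        ((hcore _ h4).trans le_self_add)
      rwa [ENNReal.zero_rpow_of_pos hr0] at this
    -- Each level occurs at most twice, as upper or lower end of an increment; the last core term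
    -- fills the missing upper end at `m`.
    have hsum : ∑ i ∈ Finset.range m,
        ‖T (𝒟.truncate α f (q i) - 𝒟.truncate α f (q (i + 1))) s‖ₑ ^ r +
          ‖T (𝒟.truncate α f (q m)) s‖ₑ ^ r ≤
        2 * (3 ^ r * ∑ i ∈ Finset.range (m + 1), l i ^ r) := by
      refine (add_le_add hA hB).trans ?_
      rw [← Finset.mul_sum, ← mul_add, Finset.sum_add_distrib]
      have h6 : ∑ i ∈ Finset.range m, l (i + 1) ^ r ≤ ∑ i ∈ Finset.range (m + 1), l i ^ r := by
        rw [Finset.sum_range_succ' (fun i => l i ^ r)]; exact le_self_add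
      calc _ = 3 ^ r * (∑ i ∈ Finset.range (m + 1), l i ^ r +
            ∑ i ∈ Finset.range m, l (i + 1) ^ r) := by
            rw [Finset.sum_range_succ]; ring
        _ ≤ 3 ^ r * (∑ i ∈ Finset.range (m + 1), l i ^ r +
            ∑ i ∈ Finset.range (m + 1), l i ^ r) := by gcongr
        _ = _ := by ring
    gcongr

end DyadicSystem

/-! ### Passage to adjacent cubes and the final estimate -/

/-- This turns a level on `Q` into a fractional average on the adjacent `Q'`: `I`, `I'` are the
integrals over `αQ` and `Q'`, and `V`, `V'`, `M` the measures of `αQ`, `αQ'`, `Q'`. -/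
theorem rpow_mul_measure_rpow_le {p₀ q₀ : ℝ} (hp : 1 ≤ p₀) (hq : 1 ≤ q₀)
    {I I' V V' M K : ℝ≥0∞} (hI : I ≤ I') (hM0 : M ≠ 0) (hM : M ≤ V') (hV' : V' ≠ ∞)
    (hVV : V' ≤ K * V) (hK : 1 ≤ K) (hKt : K ≠ ∞) :
    I ^ (1 / p₀) * V ^ (-(1 / q₀)) ≤ K * (V' ^ (1 / p₀ - 1 / q₀) * (I' / M) ^ (1 / p₀)) := by
  have hp0 : 0 < 1 / p₀ := by positivity
  have hq0 : 0 < 1 / q₀ := by positivity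
  have hq1 : 1 / q₀ ≤ 1 := by rw [div_le_one (by linarith)]; exact hq
  have hV'0 : V' ≠ 0 := fun h => hM0 (le_antisymm (h ▸ hM) bot_le)
  have hMt : M ≠ ∞ := ne_top_of_le_ne_top hV' hM
  have hK0 : K ≠ 0 := (zero_lt_one.trans_le hK).ne'
  have h1 : I ^ (1 / p₀) ≤ V' ^ (1 / p₀) * (I' / M) ^ (1 / p₀) := by
    rw [← ENNReal.mul_rpow_of_nonneg _ _ hp0.le]
    refine ENNReal.rpow_le_rpow ?_ hp0.le
    calc I ≤ I' := hI
      _ = M * (I' / M) := (ENNReal.mul_div_cancel hM0 hMt).symm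
      _ ≤ V' * (I' / M) := by gcongr
  have h2 : V ^ (-(1 / q₀)) ≤ K * V' ^ (-(1 / q₀)) := by
    have h3 : V' ^ (1 / q₀) ≤ K * V ^ (1 / q₀) := by
      refine (ENNReal.rpow_le_rpow hVV hq0.le).trans ?_
      rw [ENNReal.mul_rpow_of_nonneg _ _ hq0.le]
      gcongr
      conv_rhs => rw [← ENNReal.rpow_one K]
      exact ENNReal.rpow_le_rpow_of_exponent_le hK hq1
    rw [ENNReal.rpow_neg, ENNReal.rpow_neg]
    have h4 := ENNReal.inv_le_inv.2 h3
    rw [ENNReal.mul_inv (Or.inl hK0) (Or.inl hKt)] at h4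
    calc (V ^ (1 / q₀))⁻¹ = K * (K⁻¹ * (V ^ (1 / q₀))⁻¹) := by
          rw [← mul_assoc, ENNReal.mul_inv_cancel hK0 hKt, one_mul]
      _ ≤ _ := by gcongr
  calc I ^ (1 / p₀) * V ^ (-(1 / q₀))
      ≤ (V' ^ (1 / p₀) * (I' / M) ^ (1 / p₀)) * (K * V' ^ (-(1 / q₀))) := mul_le_mul' h1 h2
    _ = K * ((V' ^ (1 / p₀) * V' ^ (-(1 / q₀))) * (I' / M) ^ (1 / p₀)) := by ring
    _ = _ := by rw [← ENNReal.rpow_add _ _ hV'0 hV', sub_eq_add_neg]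

/-- A sum over finitely many cubes, each of which is counted at most `M` times by `φ`, is dominated
by `M` times the sum over the image. -/
theorem sum_comp_le_mul_tsum {ι κ : Type*} {F : Finset ι} {φ : ι → κ} {M : ℝ≥0∞} {𝒮 : Set κ}
    (hφ : ∀ i ∈ F, φ i ∈ 𝒮) (w w' : κ → ℝ≥0∞) (hw : ∀ i ∈ F, w (φ i) ≤ w' (φ i))
    (hM : ∀ b, ∀ F' ⊆ F, (∀ i ∈ F', φ i = b) → (F'.card : ℝ≥0∞) ≤ M) :
    ∑ i ∈ F, w (φ i) ≤ M * ∑' b : 𝒮, w' b := by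
  classical
  calc ∑ i ∈ F, w (φ i) ≤ ∑ i ∈ F, w' (φ i) := Finset.sum_le_sum hw
    _ = ∑ b ∈ F.image φ, (F.filter fun i => φ i = b).card • w' b := Finset.sum_comp _ _
    _ ≤ ∑ b ∈ F.image φ, M * w' b := by
        refine Finset.sum_le_sum fun b _ => ?_
        rw [nsmul_eq_mul]
        gcongr
        exact hM b _ (Finset.filter_subset _ _) fun i hi => (Finset.mem_filter.1 hi).2
    _ = M * ∑ b ∈ F.image φ, 𝒮.indicator w' b := by
        rw [Finset.mul_sum]
        refine Finset.sum_congr rfl fun b hb => ?_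
        obtain ⟨i, hi, rfl⟩ := Finset.mem_image.1 hb
        rw [Set.indicator_of_mem (hφ i hi)]
    _ ≤ M * ∑' b, 𝒮.indicator w' b := by gcongr; exact ENNReal.sum_le_tsum _
    _ = _ := by rw [tsum_subtype 𝒮 w']

/-- Apply adjacency to the ball `αQ`. The factor `2` with `γ` turns the non-strict diameter bound
into membership in an open ball. -/
theorem exists_adjacent_cube {S : Type u} [MeasurableSpace S] {μ : Measure S} {cd cμ : ℝ}
    {H : HomogeneousSpace μ cd cμ} {c₀ C₀ δ γ α : ℝ} {m : ℕ} {D : Fin m → DyadicSystem H c₀ C₀ δ}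
    (hD : AdjacentSystems D γ) (hc : 0 < c₀) (hC : 0 < C₀) (hδ : 0 < δ)
    (hα : 1 ≤ α) (hγ : 1 ≤ γ) (𝒟 : DyadicSystem H c₀ C₀ δ) (Q : 𝒟.Idx) :
    ∃ Q' : Cube D, 𝒟.dilation α Q ⊆ Q'.carrier ∧
      μ Q'.carrier ≤ doublingConst cμ (2 * γ * α * C₀ / c₀) * μ (𝒟.carrier Q) := by
  have hrad : 0 < C₀ * δ ^ 𝒟.gen Q := mul_pos hC (zpow_pos hδ _)
  obtain ⟨j, k, i, hsub, hdiam⟩ := hD (𝒟.mid Q) (α * (C₀ * δ ^ 𝒟.gen Q)) (by positivity)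
  refine ⟨⟨j, k, i⟩, hsub, ?_⟩
  have hmid : 𝒟.mid Q ∈ (D j).cube k i := hsub (H.mem_ball_self (by positivity))
  calc μ ((D j).cube k i) ≤ μ (H.ball (𝒟.mid Q) (2 * γ * α * (C₀ * δ ^ 𝒟.gen Q))) := by
        refine measure_mono fun x hx => ?_
        rw [HomogeneousSpace.mem_ball]
        have h1 := hdiam _ hmid x hx
        have h2 : 0 < γ * (α * (C₀ * δ ^ 𝒟.gen Q)) := by positivity
        nlinarith
    _ ≤ doublingConst cμ (2 * γ * α * C₀ / c₀) * μ (H.ball (𝒟.mid Q) (c₀ * δ ^ 𝒟.gen Q)) :=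
        H.measure_ball_le_doublingConst _ (mul_pos hc (zpow_pos hδ _)) (le_of_eq (by field_simp))
    _ ≤ _ := by gcongr; exact 𝒟.ball_subset_carrier Q

theorem exists_sparse_domination (cd cμ : ℝ) (hcd : 1 ≤ cd) (hcμ : 1 ≤ cμ)
    (c₀ C₀ γ δ : ℝ) (m : ℕ) (hc : 0 < c₀) (hcC : c₀ ≤ C₀) (hγ : 1 ≤ γ) (hδ : 0 < δ) (hδ1 : δ < 1)
    (α : ℝ) (hα : 3 * cd ^ 2 / δ ≤ α) :
    ∃ C : ℝ, 0 < C ∧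
    ∀ (S : Type u) [MeasurableSpace S] (μ : Measure S) (H : HomogeneousSpace μ cd cμ)
      (D : Fin m → DyadicSystem H c₀ C₀ δ), AdjacentSystems D γ →
    ∀ (X : Type v) [NormedAddCommGroup X] (Y : Type w) [NormedAddCommGroup Y]
      (p₀ q₀ r : ℝ), 1 ≤ p₀ → 1 ≤ q₀ → 1 ≤ r →
    ∀ T : Lp X (ENNReal.ofReal p₀) μ → (S →ₘ[μ] Y), (∀ g h, T (g - h) = T g - T h) →
      weakOpNorm q₀ (fun f s => ‖T f s‖ₑ) < ∞ →
      weakOpNorm q₀ (sharpMaximal H α T) < ∞ →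
    ∀ Cr : ℝ, 0 < Cr → IsSublinearWith H r Cr T →
    ∃ η : ℝ, 0 < η ∧ η < 1 ∧
      ∀ f : Lp X (ENNReal.ofReal p₀) μ, BoundedlySupported H f →
        ∃ 𝒮 : Set (Cube D), IsSparse η 𝒮 ∧
          ∀ᵐ s ∂μ, ‖T f s‖ₑ ≤
            ENNReal.ofReal C *
              (weakOpNorm q₀ (fun f s => ‖T f s‖ₑ) + weakOpNorm q₀ (sharpMaximal H α T)) *
              ENNReal.ofReal Cr * fractionalSparse 𝒮 α p₀ q₀ r f s := by
  have hC : 0 < C₀ := hc.trans_le hcC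
  have hα3 : 3 * cd ≤ α := by
    refine le_trans ?_ hα
    rw [le_div_iff₀ hδ]
    nlinarith
  have hα1 : 1 ≤ α := by linarith
  have hα0 : 0 < α := by linarith
  obtain ⟨N, hN, hNδ⟩ : ∃ N : ℕ, 1 ≤ N ∧ cd * δ ^ N ≤ 2 / 3 := by
    obtain ⟨n, hn⟩ := exists_pow_lt_of_lt_one (y := δ) (x := 2 / 3 / cd) (by positivity) hδ1
    refine ⟨n + 1, by omega, ?_⟩
    rw [lt_div_iff₀ (by linarith)] at hn
    have : cd * δ ^ n * δ ≤ cd * δ ^ n * 1 :=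
      mul_le_mul_of_nonneg_left hδ1.le (by positivity)
    rw [pow_succ]
    linarith
  set K₁ := doublingConst cμ (2 * cd * C₀ / (c₀ * δ ^ N)) with hK₁
  set K₂ := doublingConst cμ (2 * γ * α * C₀ / c₀) with hK₂
  set K₃ := doublingConst cμ (α * C₀ / c₀) with hK₃
  have h1K₁ : 1 ≤ K₁ := one_le_doublingConst hcμ _
  have h1K₂ : 1 ≤ K₂ := one_le_doublingConst hcμ _
  have h1K₃ : 1 ≤ K₃ := one_le_doublingConst hcμ _
  have htK₁ : K₁ ≠ ∞ := doublingConst_ne_top _ _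
  have htK₂ : K₂ ≠ ∞ := doublingConst_ne_top _ _
  have htK₃ : K₃ ≠ ∞ := doublingConst_ne_top _ _
  have hne : ∀ {K : ℝ≥0∞}, 1 ≤ K → K ≠ 0 := fun h => (zero_lt_one.trans_le h).ne'
  -- This makes the exceptional fraction `2 Λ⁻¹ K₃` equal to `θ / 2`: the factor `θ` is spent on the
  -- density threshold, and `1 / 2` remains as the decay of the children.
  set Λ : ℝ≥0∞ := 16 * K₁ * K₃ with hΛ
  have htΛ : Λ ≠ ∞ := ENNReal.mul_ne_top (ENNReal.mul_ne_top (by simp) htK₁) htK₃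
  have h1Λ : 1 ≤ Λ := one_le_mul (one_le_mul (by norm_num) h1K₁) h1K₃
  set θ : ℝ≥0∞ := (4 * K₁)⁻¹ with hθ
  have hΛθ : 2 * Λ⁻¹ * K₃ = 2⁻¹ * θ := by
    have h16 : (16 : ℝ≥0∞)⁻¹ = 2⁻¹ * 2⁻¹ * 4⁻¹ := by
      rw [← ENNReal.mul_inv (by simp) (by simp), ← ENNReal.mul_inv (by simp) (by simp)]
      norm_num
    rw [hΛ, hθ, ENNReal.mul_inv (Or.inr htK₃) (Or.inr (hne h1K₃)),
      ENNReal.mul_inv (by simp) (by simp), ENNReal.mul_inv (by simp) (by simp), h16]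
    calc 2 * (2⁻¹ * 2⁻¹ * 4⁻¹ * K₁⁻¹ * K₃⁻¹) * K₃
        = (2 * 2⁻¹) * (K₃ * K₃⁻¹) * (2⁻¹ * (4⁻¹ * K₁⁻¹)) := by ring
      _ = _ := by
        rw [ENNReal.mul_inv_cancel two_ne_zero ENNReal.ofNat_ne_top,
          ENNReal.mul_inv_cancel (hne h1K₃) htK₃, one_mul, one_mul]
  -- The `6 = 2 · 3` comes from the chain estimate, `Λ` from the levels, `K₂ K₃` from comparing `αQ`
  -- with `αQ'`, and `2 K₂` from the multiplicity of `Q ↦ Q'`.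
  set B : ℝ≥0∞ := 6 * (Λ * (K₂ * K₃)) * (2 * K₂) with hB
  have htM : 2 * K₂ ≠ ∞ := ENNReal.mul_ne_top (by simp) htK₂
  have h2M : 2 ≤ 2 * K₂ := le_mul_of_one_le_right' h1K₂
  have h1M : 1 ≤ 2 * K₂ := one_le_two.trans h2M
  have htB : B ≠ ∞ := ENNReal.mul_ne_top (ENNReal.mul_ne_top (by simp)
    (ENNReal.mul_ne_top htΛ (ENNReal.mul_ne_top htK₂ htK₃))) htM
  have hB0 : B ≠ 0 := hne (one_le_mul (one_le_mul (by norm_num)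
    (one_le_mul h1Λ (one_le_mul h1K₂ h1K₃))) h1M)
  refine ⟨B.toReal, ENNReal.toReal_pos hB0 htB, ?_⟩
  intro S _ μ H D hD X _ Y _ p₀ q₀ r hp hq hr T hsubT hTfin hMfin Cr hCr hT
  have hinvM : (2 * K₂)⁻¹ ≠ ∞ := ENNReal.inv_ne_top.2 (hne h1M)
  refine ⟨(2 * K₂)⁻¹.toReal, ENNReal.toReal_pos (ENNReal.inv_ne_zero.2 htM) hinvM, ?_, ?_⟩
  · rw [← ENNReal.toReal_one, ENNReal.toReal_lt_toReal hinvM ENNReal.one_ne_top,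
      ENNReal.inv_lt_one]
    exact ENNReal.one_lt_two.trans_le h2M
  rintro f ⟨c, ρ, hf⟩
  -- Adjacency is used here only to know that there is at least one system.
  obtain ⟨j₀, -⟩ := hD c 1 one_pos
  set 𝒟 := D j₀
  set W := weakOpNorm q₀ (fun f s => ‖T f s‖ₑ) + weakOpNorm q₀ (sharpMaximal H α T) with hW
  have hWt : W < ∞ := ENNReal.add_lt_top.2 ⟨hTfin, hMfin⟩
  obtain ⟨roots, huniq, hcover, hroots⟩ := 𝒟.exists_roots hcd hc hC hδ hδ1 hα c ρ
  obtain ⟨stops, E, hE, hEdisj, hdom⟩ := DyadicSystem.exists_chain_domination (𝒟 := 𝒟) (T := T)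
    (f := f) (q₀ := q₀) (Λ := Λ) (W := W) (θ := θ) hcd hcμ hc hC hδ hδ1 hα3 hN hNδ hsubT hr hCr hT
    hθ (fun Q => by
      rw [← hΛθ]
      exact DyadicSystem.measure_exceptional_le hp hq hc hC hδ hα0 le_self_add le_add_self hWt
        h1Λ htΛ Q) huniq hcover
    (fun Q hQ => hf.mono fun s hs hsQ => hs fun h => hsQ (hroots Q hQ h))
  choose adj hadj hadjμ using
    fun Q : 𝒟.Idx => exists_adjacent_cube hD hc hC hδ hα1 hγ 𝒟 Q
  have hQadj : ∀ Q, 𝒟.carrier Q ⊆ (adj Q).carrier := fun Q =>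
    (𝒟.carrier_subset_dilation hC hδ hα1 Q).trans (hadj Q)
  have hμE : ∀ Q ∈ stops, μ (adj Q).carrier ≤ 2 * K₂ * μ (E Q) := by
    intro Q hQ
    calc μ (adj Q).carrier ≤ K₂ * μ (𝒟.carrier Q) := hadjμ Q
      _ ≤ K₂ * (2 * μ (E Q)) := by gcongr; exact (hE Q hQ).2.2
      _ = _ := by ring
  have hpos : ∀ Q' : Cube D, μ Q'.carrier ≠ 0 := fun Q' =>
    ((D Q'.sys).measure_carrier_pos hc hδ ⟨Q'.gen, Q'.idx⟩).ne'
  have hlt : ∀ Q' : Cube D, μ Q'.carrier ≠ ∞ := fun Q' =>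
    ((D Q'.sys).measure_carrier_lt_top hC hδ ⟨Q'.gen, Q'.idx⟩).ne
  refine ⟨adj '' stops, ?_, ?_⟩
  · have : Nonempty 𝒟.Idx := ⟨𝒟.cubeAt 0 c⟩
    -- Several stopping cubes may share one adjacent cube; the set `E` of a single chosen preimage
    -- suffices for sparseness.
    choose! pre hpre hpre' using
      fun (Q' : Cube D) (h : Q' ∈ adj '' stops) => (Set.mem_image _ _ _).1 h
    refine ⟨fun Q' => E (pre Q'), fun Q' hQ' => ?_, fun P' hP' Q' hQ' hne => ?_⟩
    · obtain ⟨h1, h2, -⟩ := hE _ (hpre Q' hQ')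
      have h3 := hμE _ (hpre Q' hQ')
      have h4 := hQadj (pre Q')
      rw [hpre' Q' hQ'] at h3 h4
      refine ⟨h1, h2.trans h4, ?_⟩
      rw [ENNReal.ofReal_toReal hinvM, mul_comm, ← div_eq_mul_inv]
      exact ENNReal.div_le_of_le_mul' h3
    · refine hEdisj _ (hpre P' hP') _ (hpre Q' hQ') fun h => hne ?_
      rw [← hpre' P' hP', ← hpre' Q' hQ', h]
  · have hr0 : 0 < r := by linarith
    set w : Cube D → ℝ≥0∞ := fun Q' => μ (Q'.dilate α) ^ (r / p₀ - r / q₀) *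
      ((⨍⁻ x in Q'.carrier, ‖f x‖ₑ ^ p₀ ∂μ) ^ (1 / p₀)) ^ r with hw
    set A := Λ * (K₂ * K₃) * W with hA
    have hlevel : ∀ Q, 𝒟.level α p₀ q₀ Λ W f Q ^ r ≤ A ^ r * w (adj Q) := by
      intro Q
      set D' := D (adj Q).sys
      set Q₀ : D'.Idx := ⟨(adj Q).gen, (adj Q).idx⟩
      have hV' : μ (D'.dilation α Q₀) ≤ K₂ * K₃ * μ (𝒟.dilation α Q) := by
        calc μ (D'.dilation α Q₀) ≤ K₃ * μ (D'.carrier Q₀) := D'.measure_dilation_le hc hδ α Q₀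
          _ ≤ K₃ * (K₂ * μ (𝒟.carrier Q)) := by gcongr; exact hadjμ Q
          _ ≤ K₃ * (K₂ * μ (𝒟.dilation α Q)) := by
            gcongr; exact 𝒟.carrier_subset_dilation hC hδ hα1 Q
          _ = _ := by ring
      have hV't := (D'.measure_dilation_lt_top hC hδ hα0 Q₀).ne
      have h := rpow_mul_measure_rpow_le hp hq (lintegral_mono_set (f := fun x => ‖f x‖ₑ ^ p₀)
        (μ := μ) (hadj Q)) (hpos (adj Q))
        (measure_mono (D'.carrier_subset_dilation hC hδ hα1 Q₀)) hV't hV'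
        (one_le_mul h1K₂ h1K₃) (ENNReal.mul_ne_top htK₂ htK₃)
      calc 𝒟.level α p₀ q₀ Λ W f Q ^ r
          = (Λ * W * ((∫⁻ x in 𝒟.dilation α Q, ‖f x‖ₑ ^ p₀ ∂μ) ^ (1 / p₀) *
              μ (𝒟.dilation α Q) ^ (-(1 / q₀)))) ^ r := by
            rw [DyadicSystem.level]; congr 1; ring
        _ ≤ (Λ * W * (K₂ * K₃ * (μ (D'.dilation α Q₀) ^ (1 / p₀ - 1 / q₀) *
              ((∫⁻ x in (adj Q).carrier, ‖f x‖ₑ ^ p₀ ∂μ) / μ (adj Q).carrier) ^ (1 / p₀)))) ^ r := by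
            gcongr
        _ = (A * (μ (D'.dilation α Q₀) ^ (1 / p₀ - 1 / q₀) *
              (⨍⁻ x in (adj Q).carrier, ‖f x‖ₑ ^ p₀ ∂μ) ^ (1 / p₀))) ^ r := by
            rw [setLAverage_eq]; congr 1; ring
        _ = A ^ r * w (adj Q) := by
            rw [ENNReal.mul_rpow_of_nonneg A _ hr0.le,
              ENNReal.mul_rpow_of_nonneg (μ (D'.dilation α Q₀) ^ (1 / p₀ - 1 / q₀)) _ hr0.le,
              ← ENNReal.rpow_mul, show (1 / p₀ - 1 / q₀) * r = r / p₀ - r / q₀ by ring]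
            rfl
    filter_upwards [hdom] with s hs
    obtain ⟨n, q, hq1, hq2, hq3⟩ := hs
    have hgen : ∀ i j, i < j → j ≤ n → 𝒟.gen (q i) < 𝒟.gen (q j) := by
      intro i j hij
      induction j, hij using Nat.le_induction with
      | base => exact fun h => hq2 i (by omega)
      | succ j hij ih => exact fun h => (ih (by omega)).trans (hq2 j (by omega))
    have hinj : ∀ i ≤ n, ∀ j ≤ n, i ≠ j → q i ≠ q j := by
      intro i hi j hj hij h
      rcases lt_or_gt_of_ne hij with h' | h'
      · exact absurd (hgen i j h' hj) (by rw [h]; exact lt_irrefl _)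
      · exact absurd (hgen j i h' hi) (by rw [h]; exact lt_irrefl _)
    set total := ∑' Q' : (adj '' stops : Set (Cube D)), (Q' : Cube D).carrier.indicator
      (fun _ => w Q') s with htotal
    have hsum : ∑ i ∈ Finset.range (n + 1), w (adj (q i)) ≤ 2 * K₂ * total := by
      refine sum_comp_le_mul_tsum (F := Finset.range (n + 1)) (φ := fun i => adj (q i))
        (𝒮 := adj '' stops) (M := 2 * K₂) (fun i hi => ?_) w
        (fun Q' => Q'.carrier.indicator (fun _ => w Q') s) (fun i hi => ?_) ?_
      · exact ⟨q i, (hq1 i (by have := Finset.mem_range.1 hi; omega)).1, rfl⟩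
      · rw [Set.indicator_of_mem
          (hQadj _ (hq1 i (by have := Finset.mem_range.1 hi; omega)).2)]
      · intro Q' F' hF' hFQ'
        have hle : ∀ i ∈ F', i ≤ n := fun i hi => by
          have := Finset.mem_range.1 (hF' hi); omega
        -- Distinct cubes of the chain with the same `Q'` have disjoint sets `E` inside `Q'`, each
        -- carrying at least the fraction `1 / (2 K₂)` of its measure. Hence there are at most `2
        -- K₂` of them.
        have h1 : ∑ i ∈ F', μ (E (q i)) ≤ μ Q'.carrier := by
          rw [← measure_biUnion_finset (fun i hi j hj hij => hEdisj _ (hq1 i (hle i hi)).1 _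
            (hq1 j (hle j hj)).1 (hinj i (hle i hi) j (hle j hj) hij))
            (fun i hi => (hE _ (hq1 i (hle i hi)).1).1)]
          refine measure_mono (Set.iUnion₂_subset fun i hi => ?_)
          rw [← hFQ' i hi]
          exact (hE _ (hq1 i (hle i hi)).1).2.1.trans (hQadj _)
        refine (ENNReal.mul_le_mul_iff_left (hpos Q') (hlt Q')).1 ?_
        calc (F'.card : ℝ≥0∞) * μ Q'.carrier = ∑ i ∈ F', μ Q'.carrier := by simp
          _ ≤ ∑ i ∈ F', 2 * K₂ * μ (E (q i)) := Finset.sum_le_sum fun i hi => by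
            have := hμE _ (hq1 i (hle i hi)).1
            rwa [hFQ' i hi] at this
          _ ≤ _ := by rw [← Finset.mul_sum]; gcongr
    have hri : 0 ≤ 1 / r := by positivity
    have hri1 : 1 / r ≤ 1 := by rw [div_le_one hr0]; exact hr
    have hroot : ∀ x : ℝ≥0∞, 1 ≤ x → x ^ (1 / r) ≤ x := fun x hx => by
      conv_rhs => rw [← ENNReal.rpow_one x]
      exact ENNReal.rpow_le_rpow_of_exponent_le hx hri1
    have hcancel : ∀ x : ℝ≥0∞, (x ^ r) ^ (1 / r) = x := fun x => by
      rw [← ENNReal.rpow_mul, mul_one_div_cancel hr0.ne', ENNReal.rpow_one]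
    have hfinal : (2 * (3 ^ r * ∑ i ∈ Finset.range (n + 1),
        𝒟.level α p₀ q₀ Λ W f (q i) ^ r)) ^ (1 / r) ≤ B * W * total ^ (1 / r) := by
      calc _ ≤ (2 * (3 ^ r * ∑ i ∈ Finset.range (n + 1), A ^ r * w (adj (q i)))) ^ (1 / r) := by
            gcongr with i hi
            exact hlevel _
        _ ≤ (2 * (3 ^ r * (A ^ r * (2 * K₂ * total)))) ^ (1 / r) := by
            rw [← Finset.mul_sum]
            gcongr
        _ = 2 ^ (1 / r) * (3 * (A * ((2 * K₂) ^ (1 / r) * total ^ (1 / r)))) := by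
            simp only [ENNReal.mul_rpow_of_nonneg _ _ hri, hcancel]
        _ ≤ 2 * (3 * (A * (2 * K₂ * total ^ (1 / r)))) := by
            gcongr
            · exact hroot _ one_le_two
            · exact hroot _ h1M
        _ = B * W * total ^ (1 / r) := by rw [hB, hA]; ring
    rw [ENNReal.ofReal_toReal htB]
    calc ‖T f s‖ₑ ≤ _ := hq3
      _ ≤ ENNReal.ofReal Cr * (B * W * total ^ (1 / r)) := by gcongr
      _ = B * W * ENNReal.ofReal Cr * total ^ (1 / r) := by ring

end

theorem theorem3p4 (cd cμ : ℝ) (hcd : 1 ≤ cd) (hcμ : 1 ≤ cμ) :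
    -- Adjacent dyadic systems exist, with parameters depending only on `cd` and `cμ`.
    (∃ (c₀ C₀ γ δ : ℝ) (m : ℕ), 0 < c₀ ∧ c₀ ≤ C₀ ∧ 1 ≤ γ ∧ 0 < δ ∧ δ < 1 ∧
      ∀ (S : Type u) [MeasurableSpace S] (μ : Measure S) (H : HomogeneousSpace μ cd cμ),
        ∃ D : Fin m → DyadicSystem H c₀ C₀ δ, AdjacentSystems D γ) ∧
    -- The sparse domination holds in any adjacent dyadic systems.
    ∀ (c₀ C₀ γ δ : ℝ) (m : ℕ), 0 < c₀ → c₀ ≤ C₀ → 1 ≤ γ → 0 < δ → δ < 1 →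
    ∀ α : ℝ, 3 * cd ^ 2 / δ ≤ α →
    ∃ C : ℝ, 0 < C ∧
    ∀ (S : Type u) [MeasurableSpace S] (μ : Measure S) (H : HomogeneousSpace μ cd cμ)
      (D : Fin m → DyadicSystem H c₀ C₀ δ), AdjacentSystems D γ →
    ∀ (𝕜 : Type z) [RCLike 𝕜]
      (X : Type v) [NormedAddCommGroup X] [NormedSpace 𝕜 X] [CompleteSpace X]
      (Y : Type w) [NormedAddCommGroup Y] [NormedSpace 𝕜 Y] [CompleteSpace Y]
      (p₀ q₀ r : ℝ), 1 ≤ p₀ → 1 ≤ q₀ → 1 ≤ r →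
    ∀ T : Lp X (ENNReal.ofReal p₀) μ →ₗ[𝕜] (S →ₘ[μ] Y),
      weakOpNorm q₀ (fun f s => ‖T f s‖ₑ) < ∞ →
      weakOpNorm q₀ (sharpMaximal H α T) < ∞ →
    ∀ Cr : ℝ, 0 < Cr → IsSublinearWith H r Cr T →
    ∃ η : ℝ, 0 < η ∧ η < 1 ∧
      ∀ f : Lp X (ENNReal.ofReal p₀) μ, BoundedlySupported H f →
        ∃ 𝒮 : Set (Cube D), IsSparse η 𝒮 ∧
          ∀ᵐ s ∂μ, ‖T f s‖ₑ ≤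
            ENNReal.ofReal C *
              (weakOpNorm q₀ (fun f s => ‖T f s‖ₑ) + weakOpNorm q₀ (sharpMaximal H α T)) *
              ENNReal.ofReal Cr * fractionalSparse 𝒮 α p₀ q₀ r f s := by

  refine ⟨exists_adjacentSystems cd cμ hcd, ?_⟩
  intro c₀ C₀ γ δ m hc hcC hγ hδ hδ1 α hα
  obtain ⟨C, hC, h⟩ := exists_sparse_domination cd cμ hcd hcμ c₀ C₀ γ δ m hc hcC hγ hδ hδ1 α hα
  refine ⟨C, hC, ?_⟩
  intro S _ μ H D hD 𝕜 _ X _ _ _ Y _ _ _ p₀ q₀ r hp hq hr T hT hM Cr hCr hsub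
  exact h S μ H D hD X Y p₀ q₀ r hp hq hr T (map_sub T) hT hM Cr hCr hsub
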